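/- **Setting.** Let $n\ge 2$. A comparison matrix is $M\in(0,1)^{n\times n}$ with $M_{ij}+M_{ji}=1$ for all $i,j$ (so $M_{ii}=1/2$); $M_{ij}$ is the probability that item $i$ wins a comparison with item $j$, and all comparisons are independent. The score of item $i$ is $\tau_i=\frac1{n-1}\sum_{j\ne i}M_{ij}$. Let $\mathcal C_p$ be the set of comparison matrices with $M_{ij}\ge p$ for all $i,j$ and with pairwise distinct scores, and for $M \in\mathcal C_0$ let $\pi$ be the permutation with $\tau_{\pi(1)}>\dots>\tau_{\pi(n)}$. Let $L\ge2$ and integers $0=k_0<k_1<\dots<k_L=n$ be given, and let $S_\ell=\{\pi(k_{\ell-1}+1),\dots,\pi(k_\ell)\}$ for $\ell=1,\dots,L$. For $i\in S_\ell$ put $$\overline\Delta_{\ell,i}=\tau_{\pi(k_{\ell-1})}-\tau_i\ (\ell\ge2),\qquad \underline\Delta_{\ell,i}=\tau_i-\tau_{\pi(k_\ell+1)}\ (\ell\le L-1),$$ and, for a function $f$, $$H_f(M)=\sum_{i\in S_1}f(\underline\Delta_{1,i})+\sum_{\ell=2}^{L-1}\sum_{i\in S_\ell}\max\{f(\underline\Delta_{\ell,i}),f(\overline\Delta_{\ell,i})\}+\sum_{i\in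 S_L}f(\overline\Delta_{L,i}).$$ Let $f_0(x)=1/x^2$ and $f_{AR}(x)=\log(2\log(2/x))/x^2$. An active ranking algorithm repeatedly chooses, depending on the outcomes of its previous comparisons and possibly on additional randomness, two items $i,j$ to compare, and receives an independent draw that says that $i$ wins with probability $M_{ij}$; or it terminates and returns sets $\widehat S_1,\dots,\widehat S_L$. It is $\delta$-accurate for $M$ if, with probability at least $1-\delta$, it terminates and returns $\widehat S_\ell=S_\ell$ for all $\ell$; it is uniformly $\delta$-accurate over a set $\mathcal C$ of matrices if it is $\delta$-accurate for every $M\in\mathcal C$. **The Active Ranking (AR) algorithm** (input $k_0,\dots,k_L$ and $\delta$). Start with $S=\{1,\dots,n\}$, $\widehat S_\ell=\emptyset$, $\widehat k_\ell=k_\ell$, $\widehat\tau_i(0)=0$. In each round $t=1,2,\dots$: (1) compare each $i\in S$ with an item chosen uniformly at random from the other $n-1$ items, and set $\widehat\tau_i(t)=\frac{t-1}{t}\widehat\tau_i(t-1)+\frac1t\mathbf 1\{i\text{ wins}\}$. (2) Let $\alpha_t=\sqrt{\log(125\,n\log(1.12\,t)/\delta)/t}$ and let $\widehat\tau_{(r)}(t)$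 be the $r$-th largest of the values $\widehat\tau_i(t)$, $i\in S$, for the current set $S$. Go through the items $j\in S$ one after the other; if for some $\ell\in\{1,\dots,L\}$ both $$\widehat k_{\ell-1}=0\ \text{ or }\ \widehat\tau_j(t)<\widehat\tau_{(\widehat k_{\ell-1})}(t)-4\alpha_t,\qquad\text{and}\qquad \widehat k_\ell=|S|\ \text{ or }\ \widehat\tau_j(t)>\widehat\tau_{(\widehat k_\ell+1)}(t)+4\alpha_t,$$ then add $j$ to $\widehat S_\ell$, remove $j$ from $S$, and lower $\widehat k_{\ell'}$ by one for all $\ell'\ge\ell$. (3) If $S=\emptyset$, terminate and return $\widehat S_1,\dots,\widehat S_L$. **Theorem.** There are universal constants $c_{\rm up},c_{\rm low}>0$ such that for all $n\ge 2$, $L\ge 2$, all $0=k_0<\dots<k_L=n$ and all $\delta\in(0,0.14]$: (a) For every $M\in\mathcal C_0$, the AR algorithm is $\delta$-accurate for $M$; moreover, with probability at least $1-\delta$ it terminates, returns the correct sets $S_1,\dots,S_L$, and uses at most $c_{\rm up}\log(n/\delta)\,H_{f_{AR}}(M)$ comparisons. (b) Every active ranking algorithm that is uniformly $\delta$-accurate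 over $\mathcal C_{1/8}$ makes, when applied to any $M\in\mathcal C_{3/8}$, at least $c_{\rm low}\log\!\big(\tfrac1{2\delta}\big)\,H_{f_0}(M)$ comparisons in expectation. -/

import Mathlib

open scoped ENNReal

noncomputable section

namespace ActiveRanking

/-! ### Comparison models, scores and the target partition

Items are the elements of `Fin n`, so item `i` of the text is `i - 1` here, and the `L` sets of the
partition are indexed by `Fin L`.  -/

/-- A pairwise comparison matrix: `prob i j ∈ (0,1)` is the probability that item `i` wins a
comparison with item `j`, and every comparison has a winner (so `prob i i = 1/2`). -/
structure ComparisonMatrix (n : ℕ) where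
  prob : Fin n → Fin n → ℝ
  prob_pos : ∀ i j, 0 < prob i j
  prob_lt_one : ∀ i j, prob i j < 1
  prob_add_swap : ∀ i j, prob i j + prob j i = 1

variable {n L : ℕ}

/-- The score of item `i`: the probability that it beats an item chosen uniformly at random from
the other `n - 1` items. -/
def score (M : ComparisonMatrix n) (i : Fin n) : ℝ :=
  (1 / ((n : ℝ) - 1)) * ∑ j ∈ Finset.univ.erase i, M.prob i j

/-- The matrices with all entries at least `pmin` and with pairwise distinct scores. -/
def comparisonClass (n : ℕ) (pmin : ℝ) : Set (ComparisonMatrix n) :=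
  {M | (∀ i j, pmin ≤ M.prob i j) ∧ ∀ i j, i ≠ j → score M i ≠ score M j}

/-- The permutation that orders the items by decreasing score: `ranking M r` is the item with
the `(r+1)`-st largest score. -/
def ranking (M : ComparisonMatrix n) : Equiv.Perm (Fin n) :=
  Tuple.sort (fun i => - score M i)

theorem ranking_strictAnti {M : ComparisonMatrix n} {pmin : ℝ} (hM : M ∈ comparisonClass n pmin) :
    StrictAnti (fun r => score M (ranking M r)) := by
  intro r s hrs
  have h1 : - score M (ranking M r) ≤ - score M (ranking M s) :=
    Tuple.monotone_sort (fun i => - score M i) hrs.le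
  have h2 : score M (ranking M r) ≠ score M (ranking M s) :=
    hM.2 _ _ (fun h => hrs.ne ((ranking M).injective h))
  exact lt_of_le_of_ne (by linarith) h2.symm

/-- The borders `0 = k 0 < k 1 < ... < k L = n` of a ranking problem. -/
def IsBorders (n L : ℕ) (k : Fin (L + 1) → ℕ) : Prop :=
  k 0 = 0 ∧ StrictMono k ∧ k (Fin.last L) = n

/-- The set of the items at the (one-based) positions `k ℓ + 1, ..., k (ℓ+1)` of the ranking. -/
def targetSet (k : Fin (L + 1) → ℕ) (M : ComparisonMatrix n) (l : Fin L) : Finset (Fin n) :=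
  (Finset.univ.filter
    (fun r : Fin n => k l.castSucc ≤ (r : ℕ) ∧ (r : ℕ) < k l.succ)).image (ranking M)

/-- The `r`-th largest score, with one-based rank `r ∈ {1, ..., n}`. -/
def orderedScore (M : ComparisonMatrix n) (r : ℕ) : ℝ :=
  if h : r - 1 < n then score M (ranking M ⟨r - 1, h⟩) else 0

/-- The gap of item `i` to the last item in front of the set with index `l` (used when `l` is not
the first index). -/
def gapUp (k : Fin (L + 1) → ℕ) (M : ComparisonMatrix n) (l : Fin L) (i : Fin n) : ℝ :=
  orderedScore M (k l.castSucc) - score M i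

/-- The gap of item `i` to the first item behind the set with index `l` (used when `l` is not
the last index). -/
def gapLo (k : Fin (L + 1) → ℕ) (M : ComparisonMatrix n) (l : Fin L) (i : Fin n) : ℝ :=
  score M i - orderedScore M (k l.succ + 1)

def f₀ (x : ℝ) : ℝ := 1 / x ^ 2

def fAR (x : ℝ) : ℝ := Real.log (2 * Real.log (2 / x)) / x ^ 2

/-- The sum over all items of `f` of the relevant gaps: the lower gap for items of the first set,
the upper gap for items of the last set, and the larger of the two values in between. -/
def gapSum (f : ℝ → ℝ) (k : Fin (L + 1) → ℕ) (M : ComparisonMatrix n) : ℝ :=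
  ∑ l : Fin L, ∑ i ∈ targetSet k M l,
    if (l : ℕ) = 0 then f (gapLo k M l i)
    else if (l : ℕ) + 1 = L then f (gapUp k M l i)
    else max (f (gapLo k M l i)) (f (gapUp k M l i))

/-! ### Active ranking algorithms -/

/-- The sets returned by a ranking algorithm. -/
abbrev Output (n L : ℕ) := Fin L → Finset (Fin n)

/-- The comparisons made so far, the most recent one first: the entry `((i, j), b)` records a
comparison of `i` with `j`, which `i` won if and only if `b = true`. -/
abbrev History (n : ℕ) := List ((Fin n × Fin n) × Bool)

inductive Action (n L : ℕ) where
  | compare (i j : Fin n) : Action n L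
  | terminate (out : Output n L) : Action n L

/-- An active ranking algorithm: depending on the history, and possibly on additional
randomness, it compares two items of its choice or terminates with an output. -/
abbrev RankingAlgorithm (n L : ℕ) := History n → PMF (Action n L)

/-- The result of one comparison of `i` with `j`: `true` (`i` wins) with probability
`M.prob i j`. -/
def outcome (M : ComparisonMatrix n) (i j : Fin n) : PMF Bool :=
  PMF.ofFintype (fun b => ENNReal.ofReal (if b then M.prob i j else 1 - M.prob i j)) (by
    have h1 := (M.prob_pos i j).le
    have h2 : 0 ≤ 1 - M.prob i j := by linarith [M.prob_lt_one i j]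
    simp [← ENNReal.ofReal_add h1 h2])

/-- The comparisons made so far, with the output once the algorithm has terminated. -/
abbrev Config (n L : ℕ) := History n × Option (Output n L)

/-- One step of the interaction; each comparison is a fresh independent draw. -/
def step (A : RankingAlgorithm n L) (M : ComparisonMatrix n) : Config n L → PMF (Config n L)
  | (h, some out) => PMF.pure (h, some out)
  | (h, none) => (A h).bind fun a =>
      match a with
      | .terminate out => PMF.pure (h, some out)
      | .compare i j => (outcome M i j).map fun b => (((i, j), b) :: h, none)

/-- The law of the configuration after `t` steps. -/
def run (A : RankingAlgorithm n L) (M : ComparisonMatrix n) : ℕ → PMF (Config n L)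
  | 0 => PMF.pure ([], none)
  | t + 1 => (run A M t).bind (step A M)

/-- The probability that the algorithm terminates with a final history and an output for which
`Q` holds.  Terminated configurations do not change any more, so the events increase with `t` and
the supremum is the limit. -/
def probTerminates (A : RankingAlgorithm n L) (M : ComparisonMatrix n)
    (Q : History n → Output n L → Prop) : ℝ≥0∞ :=
  ⨆ t : ℕ, (run A M t).toOuterMeasure {c | ∃ out, c.2 = some out ∧ Q c.1 out}

/-- The expected total number of comparisons (possibly `∞`): the number of comparisons made within
`t` steps increases with `t`, so by monotone convergence the supremum of its expectations is the
expectation of the total number. -/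
def expectedComparisons (A : RankingAlgorithm n L) (M : ComparisonMatrix n) : ℝ≥0∞ :=
  ⨆ t : ℕ, ∑' c : Config n L, run A M t c * (c.1.length : ℝ≥0∞)

/-- `A` is `δ`-accurate for `M`: it returns the correct partition with probability at least
`1 - δ`. -/
def IsAccurate (k : Fin (L + 1) → ℕ) (δ : ℝ) (A : RankingAlgorithm n L)
    (M : ComparisonMatrix n) : Prop :=
  ENNReal.ofReal (1 - δ) ≤ probTerminates A M (fun _ out => out = targetSet k M)

/-- `A` is uniformly `δ`-accurate over the set `C` of comparison matrices. -/
def IsUniformlyAccurate (k : Fin (L + 1) → ℕ) (δ : ℝ) (A : RankingAlgorithm n L)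
    (C : Set (ComparisonMatrix n)) : Prop :=
  ∀ M ∈ C, IsAccurate k δ A M

/-! ### The active ranking (AR) algorithm -/

/-- The memory of the AR algorithm. -/
structure ARState (n L : ℕ) where
  /-- the current round `t ≥ 1` -/
  round : ℕ
  /-- the items not ranked yet -/
  active : Finset (Fin n)
  /-- the estimates of the sets of the partition -/
  est : Output n L
  /-- the borders of the sets, relative to the active items -/
  border : Fin (L + 1) → ℕ
  /-- the estimates of the scores -/
  scoreEst : Fin n → ℝ
  /-- the active items that have yet to be compared in the current round, in this order -/
  pending : List (Fin n)

/-- The width `α_t` of the confidence intervals. -/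
def confWidth (n : ℕ) (δ : ℝ) (t : ℕ) : ℝ :=
  √(Real.log (125 * n * Real.log (1.12 * t) / δ) / t)

/-- The `k`-th largest (`k ≥ 1`) of the values of `f` on `S`, counted with multiplicity. -/
def kthLargest (S : Finset (Fin n)) (f : Fin n → ℝ) (k : ℕ) : ℝ :=
  ((S.val.map f).sort (· ≥ ·)).getD (k - 1) 0

/-- The test by which item `j` is assigned to the set with index `l`. -/
def ARState.Assigns (s : ARState n L) (δ : ℝ) (j : Fin n) (l : Fin L) : Prop :=
  (s.border l.castSucc = 0 ∨
    s.scoreEst j < kthLargest s.active s.scoreEst (s.border l.castSucc)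
      - 4 * confWidth n δ s.round) ∧
  (s.border l.succ = s.active.card ∨
    s.scoreEst j > kthLargest s.active s.scoreEst (s.border l.succ + 1)
      + 4 * confWidth n δ s.round)

open Classical in
/-- Assign item `j` to a set if the test for that set holds, remove it from the active items, and
lower by one the borders behind it.  -/
def ARState.classifyItem (δ : ℝ) (s : ARState n L) (j : Fin n) : ARState n L :=
  if h : ∃ l, s.Assigns δ j l then
    { s with
      active := s.active.erase j
      est := Function.update s.est h.choose (insert j (s.est h.choose))
      border := fun m => if h.choose.succ ≤ m then s.border m - 1 else s.border m }
  else s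

/-- The end of a round: classify the active items one after the other, and start a new round with
the items that are still active. -/
def ARState.endRound (δ : ℝ) (s : ARState n L) : ARState n L :=
  let s' := (s.active.sort (· ≤ ·)).foldl (ARState.classifyItem δ) s
  { s' with
    round := s.round + 1
    pending := s'.active.sort (· ≤ ·) }

/-- Process the result `win` of the comparison of the first pending item `i` with its random
opponent; if no other item is pending, the round ends. -/
def ARState.record (δ : ℝ) (s : ARState n L) (win : Bool) : ARState n L :=
  match s.pending with
  | [] => s
  | i :: rest =>
      let s' : ARState n L :=
        { s with
          scoreEst := Function.update s.scoreEst i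
            (((s.round : ℝ) - 1) / s.round * s.scoreEst i
              + if win then 1 / (s.round : ℝ) else 0)
          pending := rest }
      if rest = [] then s'.endRound δ else s'

/-- The initial memory. -/
def ARState.initial (k : Fin (L + 1) → ℕ) : ARState n L where
  round := 1
  active := Finset.univ
  est := fun _ => ∅
  border := k
  scoreEst := fun _ => 0
  pending := Finset.univ.sort (· ≤ ·)

/-- The memory of the AR algorithm after the comparisons in the history. -/
def arState (k : Fin (L + 1) → ℕ) (δ : ℝ) : History n → ARState n L
  | [] => ARState.initial k
  | (_, win) :: h => (arState k δ h).record δ win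

theorem erase_nonempty (hn : 2 ≤ n) (i : Fin n) : (Finset.univ.erase i).Nonempty := by
  rw [← Finset.card_pos, Finset.card_erase_of_mem (Finset.mem_univ i), Finset.card_univ,
    Fintype.card_fin]
  omega

/-- The AR algorithm: compare the next pending item with an item chosen uniformly at random from
the other `n - 1` items; terminate when no item is left. -/
def activeRanking (hn : 2 ≤ n) (k : Fin (L + 1) → ℕ) (δ : ℝ) : RankingAlgorithm n L := fun h =>
  match (arState k δ h).pending with
  | [] => PMF.pure (.terminate (arState k δ h).est)
  | i :: _ => (PMF.uniformOfFinset (Finset.univ.erase i) (erase_nonempty hn i)).map (.compare i)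

end ActiveRanking

end

open ActiveRanking

/-! Upper bound. Against a random opponent, item `i` wins with probability equal to its score. By
Hoeffding's lemma, exp(x(W - Nτ) - Nx²/8) is therefore a supermartingale in the number N of its
examinations and the number W of its wins. `itemPotential` mixes such processes over both signs and
over slopes adapted to the ranges 4^m ≤ N < 4^(m+1). The weights make its initial value at most δ/n,
yet it is at least 1 whenever the empirical score is off by more than the confidence width
(`itemPotential_zero_le`, `one_le_itemPotential`). Ville's inequality for the sum over all items
shows that, with probability at least 1 - δ, all estimates are within the width α at all times.

The rest is deterministic on that event. A test with margin 4α cannot misplace an item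
(`ARState.Assigns.mem_targetSet`), and it succeeds once the relevant gaps exceed 6α
(`ARState.assigns_of_gapsExceed`). The invariant `ARState.Tracks` carries this through the rounds:
item `i` is examined at most `T i` times, where `T i` is a round whose width is below a sixth of its
smallest relevant gap. `exists_round_confWidth_lt` finds such a round of order log(n/δ) `fAR`(gap),
and summing over the items gives the bound.

Lower bound. Fix an item with relevant gap g, and change all its winning probabilities by ±s with s
slightly below g. All other scores move the opposite way by s/(n-1), so the item crosses the border
of its set and the correct answer changes, while the matrix stays in the class with entries at least
1/8. An accurate algorithm must tell the two matrices apart, but only comparisons involving that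
item carry information, at most 10s² each in relative entropy. The change of measure
`log_mul_toOuterMeasure_le` turns this into an expected number of such comparisons of order
log(1/(2δ))/g². Each comparison involves at most two items, so summing over the items costs a factor
2. Everything is done at one fixed time t at which the correct answer has probability at least 3/4,
so no optional stopping is needed. -/

noncomputable section

namespace ActiveRanking

variable {n L : ℕ}

/-! ### Expectations with respect to probability mass functions -/

/-- The expectation of a nonnegative function. -/
def expect {α : Type*} (p : PMF α) (f : α → ℝ≥0∞) : ℝ≥0∞ := ∑' a, p a * f a

section Expect

variable {α β : Type*}

theorem expect_pure (a : α) (f : α → ℝ≥0∞) : expect (PMF.pure a) f = f a := by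
  unfold expect
  rw [tsum_eq_single a]
  · simp
  · intro b hb
    simp [PMF.pure_apply, hb]

theorem expect_bind (p : PMF α) (g : α → PMF β) (f : β → ℝ≥0∞) :
    expect (p.bind g) f = expect p fun a => expect (g a) f := by
  unfold expect
  simp_rw [PMF.bind_apply, ← ENNReal.tsum_mul_right, ← ENNReal.tsum_mul_left]
  rw [ENNReal.tsum_comm]
  simp_rw [mul_assoc]

theorem expect_map (p : PMF α) (g : α → β) (f : β → ℝ≥0∞) :
    expect (p.map g) f = expect p fun a => f (g a) := by
  rw [← PMF.bind_pure_comp, expect_bind]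
  simp [expect_pure]

theorem expect_congr {p : PMF α} {f g : α → ℝ≥0∞} (h : ∀ a ∈ p.support, f a = g a) :
    expect p f = expect p g := by
  refine tsum_congr fun a => ?_
  by_cases ha : p a = 0
  · simp [ha]
  · rw [h a ha]

theorem expect_mono {p : PMF α} {f g : α → ℝ≥0∞} (h : ∀ a ∈ p.support, f a ≤ g a) :
    expect p f ≤ expect p g := by
  refine ENNReal.tsum_le_tsum fun a => ?_
  by_cases ha : p a = 0
  · simp [ha]
  · gcongr
    exact h a ha

theorem expect_add (p : PMF α) (f g : α → ℝ≥0∞) :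
    expect p (fun a => f a + g a) = expect p f + expect p g := by
  simp [expect, mul_add, ENNReal.tsum_add]

theorem expect_const (p : PMF α) (c : ℝ≥0∞) : expect p (fun _ => c) = c := by
  simp [expect, ENNReal.tsum_mul_right, p.tsum_coe]

theorem expect_const_mul (p : PMF α) (c : ℝ≥0∞) (f : α → ℝ≥0∞) :
    expect p (fun a => c * f a) = c * expect p f := by
  simp [expect, ← ENNReal.tsum_mul_left, mul_left_comm]

theorem expect_mul_const (p : PMF α) (c : ℝ≥0∞) (f : α → ℝ≥0∞) :
    expect p (fun a => f a * c) = expect p f * c := by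
  simp_rw [mul_comm _ c, expect_const_mul]

theorem expect_sum {ι : Type*} (s : Finset ι) (p : PMF α) (f : ι → α → ℝ≥0∞) :
    expect p (fun a => ∑ i ∈ s, f i a) = ∑ i ∈ s, expect p (f i) := by
  simp only [expect, Finset.mul_sum]
  exact Summable.tsum_finsetSum fun _ _ => ENNReal.summable

open Classical in
theorem expect_indicator (p : PMF α) (s : Set α) :
    expect p (fun a => if a ∈ s then 1 else 0) = p.toOuterMeasure s := by
  rw [PMF.toOuterMeasure_apply]
  refine tsum_congr fun a => ?_
  by_cases h : a ∈ s <;> simp [h]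

theorem toOuterMeasure_add_compl (p : PMF α) (s : Set α) :
    p.toOuterMeasure s + p.toOuterMeasure sᶜ = 1 := by
  classical
  rw [← expect_indicator, ← expect_indicator, ← expect_add]
  refine Eq.trans ?_ (expect_const p 1)
  congr 1
  funext a
  by_cases h : a ∈ s <;> simp [h]

theorem expect_outcome (M : ComparisonMatrix n) (i j : Fin n) (f : Bool → ℝ≥0∞) :
    expect (outcome M i j) f =
      ENNReal.ofReal (M.prob i j) * f true + ENNReal.ofReal (1 - M.prob i j) * f false := by
  simp [expect, tsum_fintype, outcome, PMF.ofFintype_apply]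

theorem expect_uniformOfFinset (s : Finset α) (hs : s.Nonempty) (f : α → ℝ≥0∞) :
    expect (PMF.uniformOfFinset s hs) f = (s.card : ℝ≥0∞)⁻¹ * ∑ a ∈ s, f a := by
  unfold expect
  rw [tsum_eq_sum (s := s), Finset.mul_sum]
  · exact Finset.sum_congr rfl fun a ha => by simp [ha]
  · intro a ha
    simp [ha]

end Expect

/-! ### The interaction of an algorithm with the items -/

/-- The expected value of `f` after the next action of an algorithm that has not terminated. -/
def actionExpect (M : ComparisonMatrix n) (f : Config n L → ℝ≥0∞) (h : History n) :
    Action n L → ℝ≥0∞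
  | .terminate out => f (h, some out)
  | .compare i j => expect (outcome M i j) fun b => f (((i, j), b) :: h, none)

theorem expect_step_some (A : RankingAlgorithm n L) (M : ComparisonMatrix n) (h : History n)
    (out : Output n L) (f : Config n L → ℝ≥0∞) :
    expect (step A M (h, some out)) f = f (h, some out) := by
  simp [step, expect_pure]

theorem expect_step_none (A : RankingAlgorithm n L) (M : ComparisonMatrix n) (h : History n)
    (f : Config n L → ℝ≥0∞) :
    expect (step A M (h, none)) f = expect (A h) (actionExpect M f h) := by
  rw [step, expect_bind]
  congr 1
  funext a
  cases a with
  | terminate out => simp [actionExpect, expect_pure]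
  | compare i j => simp only [actionExpect, expect_map]

theorem expect_run_zero (A : RankingAlgorithm n L) (M : ComparisonMatrix n)
    (f : Config n L → ℝ≥0∞) : expect (run A M 0) f = f ([], none) := by
  simp [run, expect_pure]

theorem expect_run_succ (A : RankingAlgorithm n L) (M : ComparisonMatrix n) (t : ℕ)
    (f : Config n L → ℝ≥0∞) :
    expect (run A M (t + 1)) f = expect (run A M t) fun c => expect (step A M c) f := by
  rw [run, expect_bind]

theorem expect_step_le (A : RankingAlgorithm n L) (M : ComparisonMatrix n) (c : Config n L)
    {f g : Config n L → ℝ≥0∞} (hs : ∀ h out, f (h, some out) ≤ g (h, some out))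
    (hn : ∀ h, expect (A h) (actionExpect M f h) ≤ g (h, none)) :
    expect (step A M c) f ≤ g c := by
  obtain ⟨h, _ | out⟩ := c
  · rw [expect_step_none]; exact hn h
  · rw [expect_step_some]; exact hs h out

theorem expect_run_le_of_supermartingale (A : RankingAlgorithm n L) (M : ComparisonMatrix n)
    (f : History n → ℝ≥0∞)
    (hf : ∀ h, expect (A h) (actionExpect M (fun c => f c.1) h) ≤ f h) (t : ℕ) :
    expect (run A M t) (fun c => f c.1) ≤ f [] := by
  induction t with
  | zero => simp [expect_run_zero]
  | succ t ih =>
    rw [expect_run_succ]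
    exact (expect_mono fun c _ => expect_step_le A M c (fun _ _ => le_rfl) hf).trans ih

/-- Terminated configurations are absorbing; events at different times can thus be compared at a
common later time. -/
theorem toOuterMeasure_run_mono (A : RankingAlgorithm n L) (M : ComparisonMatrix n)
    (Q : History n → Output n L → Prop) :
    Monotone fun t => (run A M t).toOuterMeasure {c | ∃ out, c.2 = some out ∧ Q c.1 out} := by
  classical
  refine monotone_nat_of_le_succ fun t => ?_
  rw [← expect_indicator, ← expect_indicator, expect_run_succ]
  refine expect_mono fun c _ => ?_
  obtain ⟨h, _ | out⟩ := c
  · simp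
  · rw [expect_step_some]

theorem length_le_of_mem_support_run (A : RankingAlgorithm n L) (M : ComparisonMatrix n) (t : ℕ) :
    ∀ c ∈ (run A M t).support, c.1.length ≤ t := by
  induction t with
  | zero => simp [run]
  | succ t ih =>
    intro c hc
    rw [run, PMF.mem_support_bind_iff] at hc
    obtain ⟨⟨h, o⟩, hd, hc⟩ := hc
    have hl := ih _ hd
    cases o with
    | some out =>
      simp only [step, PMF.mem_support_pure_iff] at hc
      subst hc
      exact hl.trans (Nat.le_succ t)
    | none =>
      simp only [step, PMF.mem_support_bind_iff] at hc
      obtain ⟨a, -, hc⟩ := hc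
      cases a with
      | terminate out =>
        simp only [PMF.mem_support_pure_iff] at hc
        subst hc
        exact hl.trans (Nat.le_succ t)
      | compare i j =>
        simp only [PMF.mem_support_map_iff] at hc
        obtain ⟨b, -, rfl⟩ := hc
        simpa using hl

theorem expect_length_le_expectedComparisons (A : RankingAlgorithm n L) (M : ComparisonMatrix n)
    (t : ℕ) : expect (run A M t) (fun c => (c.1.length : ℝ≥0∞)) ≤ expectedComparisons A M :=
  le_iSup (fun t : ℕ => ∑' c : Config n L, run A M t c * (c.1.length : ℝ≥0∞)) t

/-! ### Order statistics -/

theorem card_filter_eq_countP_sort (S : Finset (Fin n)) (f : Fin n → ℝ) (p : ℝ → Prop)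
    [DecidablePred p] :
    (S.filter fun i => p (f i)).card = ((S.val.map f).sort (· ≥ ·)).countP (fun x => p x) := by
  rw [← Multiset.coe_countP, Multiset.sort_eq, Multiset.countP_map, Finset.card_def,
    Finset.filter_val]

theorem length_sort_map (S : Finset (Fin n)) (f : Fin n → ℝ) :
    ((S.val.map f).sort (· ≥ ·)).length = S.card := by
  simp

/-- Together with `card_kthLargest_lt` this characterizes the order statistic by counting, which
copes with ties. The hypotheses on `b` keep the default value of `getD` out of play. -/
theorem le_card_kthLargest_le (S : Finset (Fin n)) (f : Fin n → ℝ) {b : ℕ} (hb : 1 ≤ b)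
    (hbS : b ≤ S.card) : b ≤ (S.filter fun i => kthLargest S f b ≤ f i).card := by
  rw [card_filter_eq_countP_sort S f (fun x => kthLargest S f b ≤ x)]
  set l := (S.val.map f).sort (· ≥ ·) with hl
  have hlen : l.length = S.card := length_sort_map S f
  have hsort : l.Pairwise (· ≥ ·) := Multiset.pairwise_sort _ _
  have hk : kthLargest S f b = l[b - 1] := by
    unfold kthLargest
    rw [List.getD_eq_getElem]
  have h1 : (l.take b).countP (fun x => kthLargest S f b ≤ x) = b := by
    rw [List.countP_eq_length.2, List.length_take]
    · omega
    · intro x hx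
      obtain ⟨m, hm, rfl⟩ := List.mem_iff_getElem.1 hx
      rw [List.length_take] at hm
      rw [List.getElem_take, decide_eq_true_eq, hk]
      rcases Nat.lt_or_ge m (b - 1) with h | h
      · exact List.pairwise_iff_getElem.1 hsort m (b - 1) _ _ h
      · have : m = b - 1 := by omega
        subst this
        exact le_rfl
  calc b = (l.take b).countP (fun x => kthLargest S f b ≤ x) := h1.symm
    _ ≤ _ := (List.take_sublist b l).countP_le

theorem card_kthLargest_lt (S : Finset (Fin n)) (f : Fin n → ℝ) {b : ℕ} (hb : 1 ≤ b)
    (hbS : b ≤ S.card) : (S.filter fun i => kthLargest S f b < f i).card < b := by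
  rw [card_filter_eq_countP_sort S f (fun x => kthLargest S f b < x)]
  set l := (S.val.map f).sort (· ≥ ·) with hl
  have hlen : l.length = S.card := length_sort_map S f
  have hsort : l.Pairwise (· ≥ ·) := Multiset.pairwise_sort _ _
  have hk : kthLargest S f b = l[b - 1] := by
    unfold kthLargest
    rw [List.getD_eq_getElem]
  have h1 : (l.drop (b - 1)).countP (fun x => kthLargest S f b < x) = 0 := by
    rw [List.countP_eq_zero]
    intro x hx
    obtain ⟨m, hm, rfl⟩ := List.mem_iff_getElem.1 hx
    rw [List.length_drop] at hm
    rw [List.getElem_drop, decide_eq_true_eq, hk, not_lt]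
    rcases Nat.eq_zero_or_pos m with h | h
    · subst h
      exact le_rfl
    · exact List.pairwise_iff_getElem.1 hsort (b - 1) (b - 1 + m) _ _ (by omega)
  rw [← List.take_append_drop (b - 1) l, List.countP_append, h1, add_zero]
  calc _ ≤ (l.take (b - 1)).length := List.countP_le_length
    _ < b := by rw [List.length_take]; omega

theorem le_kthLargest (S : Finset (Fin n)) (f : Fin n → ℝ) {b : ℕ} (hb : 1 ≤ b)
    (hbS : b ≤ S.card) {v : ℝ} (h : b ≤ (S.filter fun i => v ≤ f i).card) :
    v ≤ kthLargest S f b := by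
  by_contra! hlt
  have := card_kthLargest_lt S f hb hbS
  have h2 : (S.filter fun i => v ≤ f i).card ≤ (S.filter fun i => kthLargest S f b < f i).card :=
    Finset.card_le_card (Finset.monotone_filter_right S fun i _ hi => hlt.trans_le hi)
  omega

theorem kthLargest_le (S : Finset (Fin n)) (f : Fin n → ℝ) {b : ℕ} (hb : 1 ≤ b)
    (hbS : b ≤ S.card) {v : ℝ} (h : (S.filter fun i => v < f i).card < b) :
    kthLargest S f b ≤ v := by
  by_contra! hlt
  have := le_card_kthLargest_le S f hb hbS
  have h2 : (S.filter fun i => kthLargest S f b ≤ f i).card ≤ (S.filter fun i => v < f i).card :=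
    Finset.card_le_card (Finset.monotone_filter_right S fun i _ hi => hlt.trans_le hi)
  omega

/-! ### Ranks and target sets -/

/-- The zero-based position of an item in the ranking. -/
def rank (M : ComparisonMatrix n) (i : Fin n) : ℕ := (ranking M).symm i

theorem rank_lt (M : ComparisonMatrix n) (i : Fin n) : rank M i < n := ((ranking M).symm i).isLt

theorem rank_ranking (M : ComparisonMatrix n) (r : Fin n) : rank M (ranking M r) = r := by
  simp [rank]

theorem mem_targetSet {k : Fin (L + 1) → ℕ} {M : ComparisonMatrix n} {l : Fin L} {i : Fin n} :
    i ∈ targetSet k M l ↔ k l.castSucc ≤ rank M i ∧ rank M i < k l.succ := by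
  simp only [targetSet, Finset.mem_image, Finset.mem_filter, Finset.mem_univ, true_and]
  constructor
  · rintro ⟨r, h, rfl⟩
    rwa [rank_ranking]
  · intro h
    exact ⟨(ranking M).symm i, h, by simp⟩

section Scores

variable {M : ComparisonMatrix n} (hM : M ∈ comparisonClass n 0)
include hM

theorem score_lt_score_iff {i j : Fin n} : score M i < score M j ↔ rank M j < rank M i := by
  have h := (ranking_strictAnti hM).lt_iff_gt (a := (ranking M).symm i) (b := (ranking M).symm j)
  simp only [Equiv.apply_symm_apply] at h
  exact h

theorem score_le_score_iff {i j : Fin n} : score M i ≤ score M j ↔ rank M j ≤ rank M i := by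
  rw [← not_lt, score_lt_score_iff hM, not_lt]

end Scores

theorem IsBorders.exists_mem_targetSet {k : Fin (L + 1) → ℕ} (hk : IsBorders n L k)
    (M : ComparisonMatrix n) (i : Fin n) : ∃ l, i ∈ targetSet k M l := by
  have hr := rank_lt M i
  have key : ∀ m : Fin (L + 1), rank M i < k m →
      ∃ l : Fin L, k l.castSucc ≤ rank M i ∧ rank M i < k l.succ := by
    intro m
    induction m using Fin.induction with
    | zero => intro h; rw [hk.1] at h; omega
    | succ l ih =>
      intro h
      by_cases hl : rank M i < k l.castSucc
      · exact ih hl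
      · exact ⟨l, not_lt.1 hl, h⟩
  obtain ⟨l, h⟩ := key (Fin.last L) (by rw [hk.2.2]; exact hr)
  exact ⟨l, mem_targetSet.2 h⟩

/-- The borders that count an item of the set `l` are exactly those that `classifyItem` lowers when
it removes the item. -/
theorem IsBorders.rank_lt_border_iff {k : Fin (L + 1) → ℕ} (hk : IsBorders n L k)
    {M : ComparisonMatrix n} {i : Fin n} {l : Fin L} (hi : i ∈ targetSet k M l)
    (m : Fin (L + 1)) : rank M i < k m ↔ l.succ ≤ m := by
  rw [mem_targetSet] at hi
  constructor
  · intro h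
    by_contra! hlt
    have : m ≤ l.castSucc := by
      rw [Fin.le_def]
      rw [Fin.lt_def] at hlt
      simp at hlt ⊢
      omega
    have := hk.2.1.monotone this
    omega
  · intro h
    exact hi.2.trans_le (hk.2.1.monotone h)

theorem IsBorders.targetSet_unique {k : Fin (L + 1) → ℕ} (hk : IsBorders n L k)
    {M : ComparisonMatrix n} {i : Fin n} {l l' : Fin L} (hi : i ∈ targetSet k M l)
    (hi' : i ∈ targetSet k M l') : l = l' := by
  have h1 := (hk.rank_lt_border_iff hi l'.succ).1 (mem_targetSet.1 hi').2
  have h2 := (hk.rank_lt_border_iff hi' l.succ).1 (mem_targetSet.1 hi).2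
  exact Fin.succ_injective _ (le_antisymm h1 h2)

theorem orderedScore_eq (M : ComparisonMatrix n) {r : ℕ} (h : r - 1 < n) :
    ∃ i, rank M i = r - 1 ∧ orderedScore M r = score M i :=
  ⟨ranking M ⟨r - 1, h⟩, by rw [rank_ranking], by rw [orderedScore, dif_pos h]⟩

theorem IsBorders.border_pos {k : Fin (L + 1) → ℕ} (hk : IsBorders n L k) {l : Fin L}
    (hl : (l : ℕ) ≠ 0) : 0 < k l.castSucc := by
  rw [← hk.1]
  apply hk.2.1
  rw [Fin.lt_def]
  simp
  omega

theorem IsBorders.border_lt {k : Fin (L + 1) → ℕ} (hk : IsBorders n L k) {l : Fin L}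
    (hl : (l : ℕ) + 1 ≠ L) : k l.succ < n := by
  have h : l.succ < Fin.last L := by
    rw [Fin.lt_def]
    have := l.isLt
    simp
    omega
  simpa [hk.2.2] using hk.2.1 h

theorem IsBorders.border_le {k : Fin (L + 1) → ℕ} (hk : IsBorders n L k) (m : Fin (L + 1)) :
    k m ≤ n := by
  rw [← hk.2.2]
  exact hk.2.1.monotone (Fin.le_last m)

/-! ### Correctness of the classification -/

/-- The gaps of item `i` that matter for its assignment to the set with index `l` exceed `w`. -/
def GapsExceed (k : Fin (L + 1) → ℕ) (M : ComparisonMatrix n) (w : ℝ) (l : Fin L)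
    (i : Fin n) : Prop :=
  ((l : ℕ) ≠ 0 → w < gapUp k M l i) ∧ ((l : ℕ) + 1 ≠ L → w < gapLo k M l i)

/-- The items that are not active have been assigned correctly. -/
structure ARState.Sound (k : Fin (L + 1) → ℕ) (M : ComparisonMatrix n) (s : ARState n L) :
    Prop where
  mem_est : ∀ i l, i ∈ s.est l ↔ i ∉ s.active ∧ i ∈ targetSet k M l
  border_eq : ∀ m, s.border m = (s.active.filter fun i => rank M i < k m).card

/-- The estimated scores of the active items are within the confidence width. -/
def ARState.Close (M : ComparisonMatrix n) (δ : ℝ) (s : ARState n L) : Prop :=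
  ∀ i ∈ s.active, |s.scoreEst i - score M i| ≤ confWidth n δ s.round

theorem confWidth_nonneg (n : ℕ) (δ : ℝ) (t : ℕ) : 0 ≤ confWidth n δ t := Real.sqrt_nonneg _

section Classification

variable {M : ComparisonMatrix n} (hM : M ∈ comparisonClass n 0) {k : Fin (L + 1) → ℕ}
  {δ : ℝ} {s : ARState n L} (hs : s.Sound k M) (hc : s.Close M δ)
include hM hs hc

/-- If `j` lay on the wrong side of a border, counting would yield an active item on the other side
whose estimate is out of order with that of `j` by more than 4α. Two errors of at most α cannot
cause this. -/
theorem ARState.Assigns.mem_targetSet {j : Fin n} (hj : j ∈ s.active) {l : Fin L}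
    (h : s.Assigns δ j l) : j ∈ targetSet k M l := by
  have hα := confWidth_nonneg n δ s.round
  set α := confWidth n δ s.round with hαdef
  rw [ActiveRanking.mem_targetSet]
  obtain ⟨h1, h2⟩ := h
  constructor
  · by_contra! hlt
    have hb := hs.border_eq l.castSucc
    set T := s.active.filter fun i => rank M i < k l.castSucc with hT
    have hjT : j ∈ T := by simp [hT, hj, hlt]
    have hTpos : 0 < T.card := Finset.card_pos.2 ⟨j, hjT⟩
    rcases h1 with h1 | h1
    · omega
    have hTle : T.card ≤ s.active.card := Finset.card_filter_le _ _
    have hK := le_card_kthLargest_le s.active s.scoreEst (b := s.border l.castSucc) (by omega)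
      (by omega)
    set U := s.active.filter fun i => kthLargest s.active s.scoreEst (s.border l.castSucc) ≤
      s.scoreEst i with hU
    have hjU : j ∉ U := by
      simp only [hU, Finset.mem_filter, not_and, not_le]
      intro _
      linarith
    -- `U` has at least as many elements as `T` but misses `j ∈ T`, so it contains an item that
    -- truly ranks behind the border.
    have : ¬ U ⊆ T := by
      intro hsub
      have hss : U ⊂ T := (Finset.ssubset_iff_of_subset hsub).2 ⟨j, hjT, hjU⟩
      have := Finset.card_lt_card hss
      omega
    obtain ⟨i, hiU, hiT⟩ := Finset.not_subset.1 this
    simp only [hU, Finset.mem_filter] at hiU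
    have hi1 := abs_le.1 (hc i hiU.1)
    have hj1 := abs_le.1 (hc j hj)
    have hlt' : score M j < score M i := by linarith [hiU.2]
    rw [score_lt_score_iff hM] at hlt'
    exact hiT (by simp only [hT, Finset.mem_filter]; exact ⟨hiU.1, hlt'.trans hlt⟩)
  · by_contra! hge
    have hb := hs.border_eq l.succ
    set T := s.active.filter fun i => rank M i < k l.succ with hT
    have hjT : j ∉ T := by simp [hT, hge]
    have hTlt : T.card < s.active.card :=
      Finset.card_lt_card ((Finset.ssubset_iff_of_subset (Finset.filter_subset _ _)).2
        ⟨j, hj, hjT⟩)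
    rcases h2 with h2 | h2
    · omega
    have hK := card_kthLargest_lt s.active s.scoreEst (b := s.border l.succ + 1) (by omega)
      (by omega)
    set U := s.active.filter fun i => kthLargest s.active s.scoreEst (s.border l.succ + 1) <
      s.scoreEst i with hU
    have hjU : j ∈ U := by
      simp only [hU, Finset.mem_filter]
      exact ⟨hj, by linarith⟩
    have : ¬ T ⊆ U := by
      intro hsub
      have hss : T ⊂ U := (Finset.ssubset_iff_of_subset hsub).2 ⟨j, hjU, hjT⟩
      have := Finset.card_lt_card hss
      omega
    obtain ⟨i, hiT, hiU⟩ := Finset.not_subset.1 this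
    simp only [hT, Finset.mem_filter] at hiT
    simp only [hU, Finset.mem_filter, not_and, not_lt] at hiU
    have hi1 := abs_le.1 (hc i hiT.1)
    have hj1 := abs_le.1 (hc j hj)
    have hlt' : score M i < score M j := by linarith [hiU hiT.1]
    rw [score_lt_score_iff hM] at hlt'
    omega

/-- The factor is 6 = 4 + 1 + 1: the margin of the test, the error of the estimate of `j`, and the
error of the order statistic. -/
theorem ARState.assigns_of_gapsExceed (hk : IsBorders n L k) {j : Fin n} (hj : j ∈ s.active)
    {l : Fin L} (hg : GapsExceed k M (6 * confWidth n δ s.round) l j) :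
    s.Assigns δ j l := by
  have hj1 := abs_le.1 (hc j hj)
  constructor
  · by_cases hl : (l : ℕ) = 0
    · left
      have : l.castSucc = 0 := by ext; simpa using hl
      rw [hs.border_eq, this, hk.1]
      simp
    · by_cases h0 : s.border l.castSucc = 0
      · exact Or.inl h0
      right
      have hg1 := hg.1 hl
      rw [gapUp] at hg1
      have hpos := hk.border_pos hl
      -- The last item in front of the set, at zero-based rank `k l.castSucc - 1`. It may have been
      -- removed already; only its score is used.
      obtain ⟨q, hq, hqs⟩ := orderedScore_eq M (r := k l.castSucc)
        (by have := hk.border_le l.castSucc; omega)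
      have hb := hs.border_eq l.castSucc
      have hle : s.border l.castSucc ≤ s.active.card := by
        rw [hb]; exact Finset.card_filter_le _ _
      have hK : score M q - confWidth n δ s.round ≤
          kthLargest s.active s.scoreEst (s.border l.castSucc) := by
        refine le_kthLargest _ _ (by omega) hle ?_
        rw [hb]
        refine Finset.card_le_card fun i hi => ?_
        simp only [Finset.mem_filter] at hi ⊢
        have hi1 := abs_le.1 (hc i hi.1)
        have : score M q ≤ score M i := (score_le_score_iff hM).2 (by omega)
        exact ⟨hi.1, by linarith⟩
      linarith
  · by_cases hl : (l : ℕ) + 1 = L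
    · left
      have : l.succ = Fin.last L := by ext; simpa using hl
      rw [hs.border_eq, this, hk.2.2]
      congr 1
      exact Finset.filter_true_of_mem fun i _ => rank_lt M i
    · by_cases h0 : s.border l.succ = s.active.card
      · exact Or.inl h0
      right
      have hg1 := hg.2 hl
      rw [gapLo] at hg1
      have hpos := hk.border_lt hl
      obtain ⟨q, hq, hqs⟩ := orderedScore_eq M (r := k l.succ + 1) (by omega)
      have hb := hs.border_eq l.succ
      have hle : s.border l.succ ≤ s.active.card := by
        rw [hb]; exact Finset.card_filter_le _ _
      have hK : kthLargest s.active s.scoreEst (s.border l.succ + 1) ≤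
          score M q + confWidth n δ s.round := by
        refine kthLargest_le _ _ (by omega) (by omega) (Nat.lt_succ_of_le ?_)
        rw [hb]
        refine Finset.card_le_card fun i hi => ?_
        simp only [Finset.mem_filter] at hi ⊢
        have hi1 := abs_le.1 (hc i hi.1)
        have : score M q < score M i := by linarith
        rw [score_lt_score_iff hM] at this
        exact ⟨hi.1, by omega⟩
      linarith

theorem ARState.classifyItem_spec (hk : IsBorders n L k) {j : Fin n} (hj : j ∈ s.active) :
    (s.classifyItem δ j).Sound k M ∧
    (s.classifyItem δ j).round = s.round ∧
    (s.classifyItem δ j).scoreEst = s.scoreEst ∧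
    ((s.classifyItem δ j).active = s.active ∨
      (s.classifyItem δ j).active = s.active.erase j) ∧
    (∀ l, j ∈ targetSet k M l → GapsExceed k M (6 * confWidth n δ s.round) l j →
      (s.classifyItem δ j).active = s.active.erase j) := by
  unfold ARState.classifyItem
  split_ifs with h
  · have hl := h.choose_spec.mem_targetSet hM hs hc hj
    set l := h.choose
    refine ⟨⟨?_, ?_⟩, rfl, rfl, Or.inr rfl, fun _ _ _ => rfl⟩
    · intro i l'
      by_cases hij : i = j
      · subst hij
        by_cases hll : l' = l
        · subst hll
          simp [hl]
        · have : i ∉ targetSet k M l' := fun hi => hll (hk.targetSet_unique hi hl)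
          simp [Function.update_of_ne hll, hs.mem_est, this]
      · by_cases hll : l' = l
        · subst hll
          simp [hij, hs.mem_est]
        · simp [Function.update_of_ne hll, hs.mem_est, hij]
    · intro m
      simp only
      rw [Finset.filter_erase, hs.border_eq m]
      by_cases hm : l.succ ≤ m
      · rw [if_pos hm, Finset.card_erase_of_mem]
        simpa [hj] using (hk.rank_lt_border_iff hl m).2 hm
      · rw [if_neg hm, Finset.erase_eq_of_notMem]
        simpa [hj, not_lt] using mt (hk.rank_lt_border_iff hl m).1 hm
  · refine ⟨hs, rfl, rfl, Or.inl rfl, fun l _ hg => ?_⟩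
    exact absurd ⟨l, ARState.assigns_of_gapsExceed hM hs hc hk hj hg⟩ h

end Classification

/-- During the pass the estimates and the round stay fixed and the active set only shrinks, so
closeness persists although borders and order statistics change with every removal. -/
theorem ARState.foldl_classifyItem_spec {M : ComparisonMatrix n} (hM : M ∈ comparisonClass n 0)
    {k : Fin (L + 1) → ℕ} (hk : IsBorders n L k) {δ : ℝ} (js : List (Fin n)) :
    ∀ {s : ARState n L}, s.Sound k M → s.Close M δ → js.Nodup → (∀ j ∈ js, j ∈ s.active) →
      (js.foldl (ARState.classifyItem δ) s).Sound k M ∧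
      (js.foldl (ARState.classifyItem δ) s).scoreEst = s.scoreEst ∧
      (js.foldl (ARState.classifyItem δ) s).active ⊆ s.active ∧
      ∀ j ∈ js, ∀ l, j ∈ targetSet k M l → GapsExceed k M (6 * confWidth n δ s.round) l j →
        j ∉ (js.foldl (ARState.classifyItem δ) s).active := by
  induction js with
  | nil => intro s hs _ _ _; simpa using hs
  | cons j js ih =>
    intro s hs hc hnd hmem
    obtain ⟨h1, h2, h3, h4, h5⟩ := classifyItem_spec hM hs hc hk (hmem j (by simp))
    have hsub : (s.classifyItem δ j).active ⊆ s.active := by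
      rcases h4 with h | h <;> rw [h]
      exact Finset.erase_subset _ _
    rw [List.nodup_cons] at hnd
    obtain ⟨g1, g3, g4, g5⟩ := ih (s := s.classifyItem δ j) h1
      (fun i hi => by rw [h2, h3]; exact hc i (hsub hi)) hnd.2 (by
        intro i hi
        have hij : i ≠ j := fun h => hnd.1 (h ▸ hi)
        have his := hmem i (by simp [hi])
        rcases h4 with h | h <;> rw [h]
        · exact his
        · exact Finset.mem_erase.2 ⟨hij, his⟩)
    rw [List.foldl_cons]
    refine ⟨g1, g3.trans h3, g4.trans hsub, ?_⟩
    intro i hi l hil hg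
    rcases List.mem_cons.1 hi with rfl | hi
    · intro hmem'
      have := g4 hmem'
      rw [h5 l hil hg] at this
      simp at this
    · exact g5 i hi l hil (by rwa [h2])

/-! ### Exponential supermartingales -/

/-- Hoeffding's lemma for a Bernoulli variable. -/
theorem bernoulli_mgf_le {p : ℝ} (hp0 : 0 ≤ p) (hp1 : p ≤ 1) (x : ℝ) :
    p * Real.exp (x * (1 - p)) + (1 - p) * Real.exp (-(x * p)) ≤ Real.exp (x ^ 2 / 8) := by
  let q : PMF Bool := PMF.ofFintype (fun b => ENNReal.ofReal (if b then p else 1 - p)) (by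
    simp [← ENNReal.ofReal_add hp0 (sub_nonneg.2 hp1)])
  have hq : ∀ b, (q b).toReal = if b then p else 1 - p := by
    intro b
    rw [PMF.ofFintype_apply, ENNReal.toReal_ofReal]
    split_ifs <;> linarith
  let X : Bool → ℝ := fun b => if b then 1 else 0
  have hmean : ∫ b, X b ∂q.toMeasure = p := by
    rw [PMF.integral_eq_sum]
    simp [hq, X]
  have h := (ProbabilityTheory.hasSubgaussianMGF_of_mem_Icc (μ := q.toMeasure) (X := X) (a := 0)
    (b := 1) (measurable_of_countable X).aemeasurable
    (Filter.Eventually.of_forall fun b => by by_cases hb : b <;> simp [X, hb])).mgf_le x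
  rw [hmean, ProbabilityTheory.mgf, PMF.integral_eq_sum] at h
  simp only [Fintype.sum_bool, hq, X, smul_eq_mul, if_true, Bool.false_eq_true, if_false] at h
  convert h using 1
  · congr 3
    ring
  · congr 1
    norm_num
    ring

/-- An exponential supermartingale in the number `N` of comparisons and the number `W` of wins. -/
def tilt (c x τ : ℝ) (N W : ℕ) : ℝ := Real.exp (c + x * (W - N * τ) - N * x ^ 2 / 8)

/-- The term `N * x ^ 2 / 8` in the exponent pays for one application of Hoeffding's lemma per
comparison. -/
theorem tilt_step (c x : ℝ) {τ : ℝ} (h0 : 0 ≤ τ) (h1 : τ ≤ 1) (N W : ℕ) :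
    τ * tilt c x τ (N + 1) (W + 1) + (1 - τ) * tilt c x τ (N + 1) W ≤ tilt c x τ N W := by
  have e1 : tilt c x τ (N + 1) (W + 1) =
      tilt c x τ N W * Real.exp (-(x ^ 2 / 8)) * Real.exp (x * (1 - τ)) := by
    simp only [tilt, ← Real.exp_add]
    congr 1
    push_cast
    ring
  have e2 : tilt c x τ (N + 1) W =
      tilt c x τ N W * Real.exp (-(x ^ 2 / 8)) * Real.exp (-(x * τ)) := by
    simp only [tilt, ← Real.exp_add]
    congr 1
    push_cast
    ring
  have hpos : 0 < tilt c x τ N W * Real.exp (-(x ^ 2 / 8)) := by unfold tilt; positivity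
  calc _ = tilt c x τ N W * Real.exp (-(x ^ 2 / 8)) *
        (τ * Real.exp (x * (1 - τ)) + (1 - τ) * Real.exp (-(x * τ))) := by rw [e1, e2]; ring
    _ ≤ tilt c x τ N W * Real.exp (-(x ^ 2 / 8)) * Real.exp (x ^ 2 / 8) :=
        mul_le_mul_of_nonneg_left (bernoulli_mgf_le h0 h1 x) hpos.le
    _ = tilt c x τ N W := by rw [mul_assoc, ← Real.exp_add]; simp

theorem ofReal_tilt_step (c x : ℝ) {τ : ℝ} (h0 : 0 ≤ τ) (h1 : τ ≤ 1) (N W : ℕ) :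
    ENNReal.ofReal τ * ENNReal.ofReal (tilt c x τ (N + 1) (W + 1)) +
      ENNReal.ofReal (1 - τ) * ENNReal.ofReal (tilt c x τ (N + 1) W) ≤
      ENNReal.ofReal (tilt c x τ N W) := by
  have hp : ∀ N W, 0 ≤ tilt c x τ N W := fun N W => (Real.exp_pos _).le
  rw [← ENNReal.ofReal_mul h0, ← ENNReal.ofReal_mul (sub_nonneg.2 h1), ← ENNReal.ofReal_add]
  · exact ENNReal.ofReal_le_ofReal (tilt_step c x h0 h1 N W)
  · exact mul_nonneg h0 (hp _ _)
  · exact mul_nonneg (sub_nonneg.2 h1) (hp _ _)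

/-! ### Mixing the supermartingales over the scales 4^m -/

/-- The logarithmic factor in the width of the confidence intervals. -/
def logFactor (n : ℕ) (δ x : ℝ) : ℝ := Real.log (125 * n * Real.log (1.12 * x) / δ)

/-- The slope of the exponential supermartingale for the rounds from `4 ^ m` to `4 ^ (m + 1)`. -/
def stageSlope (n : ℕ) (δ : ℝ) (m : ℕ) : ℝ := 2 * √(logFactor n δ (4 ^ m)) / 2 ^ m

/-- A mixture of exponential supermartingales, one for each scale and each sign. -/
def itemPotential (n : ℕ) (δ τ : ℝ) (N W : ℕ) : ℝ≥0∞ :=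
  ∑' m : ℕ,
    (ENNReal.ofReal (tilt (-(3 / 2 * logFactor n δ (4 ^ m))) (stageSlope n δ m) τ N W) +
      ENNReal.ofReal (tilt (-(3 / 2 * logFactor n δ (4 ^ m))) (-stageSlope n δ m) τ N W))

theorem itemPotential_step (n : ℕ) (δ : ℝ) {τ : ℝ} (h0 : 0 ≤ τ) (h1 : τ ≤ 1) (N W : ℕ) :
    ENNReal.ofReal τ * itemPotential n δ τ (N + 1) (W + 1) +
      ENNReal.ofReal (1 - τ) * itemPotential n δ τ (N + 1) W ≤ itemPotential n δ τ N W := by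
  unfold itemPotential
  rw [← ENNReal.tsum_mul_left, ← ENNReal.tsum_mul_left, ← ENNReal.tsum_add]
  refine ENNReal.tsum_le_tsum fun m => ?_
  rw [mul_add, mul_add, add_add_add_comm]
  exact add_le_add (ofReal_tilt_step _ _ h0 h1 N W) (ofReal_tilt_step _ _ h0 h1 N W)

section Constants

variable {δ : ℝ} (hB : 1 ≤ (n : ℝ) / δ)
include hB

/-- The numerical constants of the width enter here: log 1.12 ≥ 0.107 and 125 · 0.107 ≥ 13, while
log 4 ≥ 1 gives linear growth in the stage. -/
theorem le_stage_arg (m : ℕ) :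
    13 * ((n : ℝ) / δ) * (m + 1) ≤ 125 * n * Real.log (1.12 * 4 ^ m) / δ := by
  have h1 : (0.107 : ℝ) ≤ Real.log 1.12 := by
    have := Real.one_sub_inv_le_log_of_pos (x := 1.12) (by norm_num)
    refine le_trans ?_ this
    norm_num
  have h4 : (1 : ℝ) ≤ Real.log 4 := by
    have : (4 : ℝ) = 2 ^ 2 := by norm_num
    rw [this, Real.log_pow]
    have := Real.log_two_gt_d9
    push_cast
    linarith
  have hlog : 0.107 + (m : ℝ) ≤ Real.log (1.12 * 4 ^ m) := by
    rw [Real.log_mul (by norm_num) (by positivity), Real.log_pow]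
    have : (m : ℝ) * 1 ≤ m * Real.log 4 := by gcongr
    linarith
  have e : 125 * (n : ℝ) * Real.log (1.12 * 4 ^ m) / δ =
      (n / δ) * (125 * Real.log (1.12 * 4 ^ m)) := by ring
  have e' : 13 * ((n : ℝ) / δ) * (m + 1) = (n / δ) * (13 * (m + 1)) := by ring
  rw [e, e']
  have hm : (0 : ℝ) ≤ m := m.cast_nonneg
  refine mul_le_mul_of_nonneg_left ?_ (by linarith)
  linarith

/-- With A the argument of the logarithm, the weight is A^(-3/2). One factor A supplies δ/n, and √A
≥ 3√(m+1) makes the weights summable over the stages. -/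
theorem exp_neg_logFactor_le (m : ℕ) :
    Real.exp (-(3 / 2 * logFactor n δ (4 ^ m))) ≤
      ((n : ℝ) / δ)⁻¹ * (1 / 39) * (1 / ((m + 1) * √(m + 1))) := by
  have hA := le_stage_arg hB m
  unfold logFactor
  set A := 125 * n * Real.log (1.12 * 4 ^ m) / δ
  have hm : (0 : ℝ) ≤ m := m.cast_nonneg
  have hAm : 9 * ((m : ℝ) + 1) ≤ A := by nlinarith
  have hA0 : 0 < A := by linarith
  have hs : 3 * √((m : ℝ) + 1) ≤ √A := by
    have : √(9 * ((m : ℝ) + 1)) ≤ √A := Real.sqrt_le_sqrt hAm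
    rw [Real.sqrt_mul (by norm_num), show (9 : ℝ) = 3 ^ 2 by norm_num,
      Real.sqrt_sq (by norm_num)] at this
    exact this
  have e : Real.exp (-(3 / 2 * Real.log A)) = (A * √A)⁻¹ := by
    rw [Real.exp_neg]
    congr 1
    have hl : √A = Real.exp (Real.log A / 2) := by
      rw [Real.exp_half, Real.exp_log hA0]
    rw [hl]
    conv_rhs => rw [← Real.exp_log hA0]
    rw [Real.log_exp, ← Real.exp_add]
    congr 1
    ring
  rw [e]
  have hsm : 0 < √((m : ℝ) + 1) := Real.sqrt_pos.2 (by linarith)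
  have hBpos : 0 < (n : ℝ) / δ := by linarith
  have e2 : ((n : ℝ) / δ)⁻¹ * (1 / 39) * (1 / ((m + 1) * √(m + 1))) =
      ((13 * ((n : ℝ) / δ) * (m + 1)) * (3 * √(m + 1)))⁻¹ := by
    simp only [one_div, mul_inv]
    rw [show (39 : ℝ) = 13 * 3 by norm_num, mul_inv]
    ring
  rw [e2]
  apply inv_anti₀
  · positivity
  · exact mul_le_mul hA hs (by positivity) hA0.le

theorem logFactor_stage_nonneg (m : ℕ) : 0 ≤ logFactor n δ (4 ^ m) := by
  have hA := le_stage_arg hB m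
  have hm : (0 : ℝ) ≤ m := m.cast_nonneg
  exact Real.log_nonneg (by nlinarith)

end Constants

/-- Telescoping: each summand is at most the increment of -6/√(m+1). -/
theorem sum_inv_mul_sqrt_le (m : ℕ) :
    ∑ i ∈ Finset.range m, (1 : ℝ) / ((i + 1) * √(i + 1)) ≤ 6 - 6 / √(m + 1) := by
  induction m with
  | zero => simp
  | succ m ih =>
    rw [Finset.sum_range_succ]
    have hm : (0 : ℝ) ≤ m := m.cast_nonneg
    push_cast
    set a := √((m : ℝ) + 1) with ha
    set b := √((m : ℝ) + 1 + 1) with hb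
    have ha2 : (m : ℝ) + 1 = a ^ 2 := (Real.sq_sqrt (by linarith)).symm
    have hb2 : (m : ℝ) + 1 + 1 = b ^ 2 := (Real.sq_sqrt (by linarith)).symm
    have ha1 : 1 ≤ a := by rw [ha]; exact Real.one_le_sqrt.2 (by linarith)
    have hb1 : 1 ≤ b := by rw [hb]; exact Real.one_le_sqrt.2 (by linarith)
    have hba : b ≤ 3 / 2 * a := by
      apply le_of_sq_le_sq _ (by linarith)
      nlinarith
    rw [ha2]
    have key : 1 / (a ^ 2 * a) ≤ 6 / a - 6 / b := by
      have : 6 / a - 6 / b = 6 / (a * b * (a + b)) := by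
        field_simp
        nlinarith
      rw [this, div_le_div_iff₀ (by positivity) (by positivity)]
      have h1 : b * (a + b) ≤ 6 * a ^ 2 := by nlinarith
      nlinarith
    linarith

/-- Two signs, the factor 1/39 and a series bounded by 6 give 12/39 < 1. -/
theorem itemPotential_zero_le {δ : ℝ} (hB : 1 ≤ (n : ℝ) / δ) (τ : ℝ) :
    itemPotential n δ τ 0 0 ≤ ENNReal.ofReal (δ / n) := by
  unfold itemPotential
  refine ENNReal.tsum_le_of_sum_range_le fun m => ?_
  have hBpos : 0 < (n : ℝ) / δ := by linarith
  have h1 : ∀ i : ℕ, ENNReal.ofReal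
      (tilt (-(3 / 2 * logFactor n δ (4 ^ i))) (stageSlope n δ i) τ 0 0) +
      ENNReal.ofReal (tilt (-(3 / 2 * logFactor n δ (4 ^ i))) (-stageSlope n δ i) τ 0 0) ≤
      ENNReal.ofReal (((n : ℝ) / δ)⁻¹ * (2 / 39) * (1 / ((i + 1) * √(i + 1)))) := by
    intro i
    rw [← ENNReal.ofReal_add (by unfold tilt; positivity) (by unfold tilt; positivity)]
    refine ENNReal.ofReal_le_ofReal ?_
    have := exp_neg_logFactor_le hB i
    simp only [tilt, Nat.cast_zero, zero_mul, sub_zero, mul_zero, add_zero, zero_div]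
    linarith
  refine (Finset.sum_le_sum fun i _ => h1 i).trans ?_
  rw [← ENNReal.ofReal_sum_of_nonneg fun i _ => by positivity, ← Finset.mul_sum]
  refine ENNReal.ofReal_le_ofReal ?_
  have h2 := sum_inv_mul_sqrt_le m
  have h3 : 0 ≤ 6 / √((m : ℝ) + 1) := by positivity
  rw [inv_div] at *
  have h4 : 0 < δ / n := by rw [← inv_div]; exact inv_pos.2 hBpos
  nlinarith

/-- A single summand suffices, that of the stage with 4^m ≤ N < 4^(m+1) and of the sign of the
deviation. Its slope is within a factor 2 of being tuned to N, measured by u = √N/2^m in [1, 2]. -/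
theorem one_le_itemPotential {δ : ℝ} (hB : 1 ≤ (n : ℝ) / δ) {τ : ℝ} {N W : ℕ} (hN : 1 ≤ N)
    (h : (N : ℝ) * confWidth n δ N < |(W : ℝ) - N * τ|) : 1 ≤ itemPotential n δ τ N W := by
  set m := Nat.log 4 N with hm
  have hlo : 4 ^ m ≤ N := Nat.pow_log_le_self 4 (by omega)
  have hhi : N < 4 ^ (m + 1) := Nat.lt_pow_succ_log_self (by norm_num) N
  have hloR : (4 : ℝ) ^ m ≤ N := by exact_mod_cast hlo
  have hhiR : (N : ℝ) < 4 ^ (m + 1) := by exact_mod_cast hhi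
  have hNpos : (0 : ℝ) < N := by exact_mod_cast hN
  have hBpos : 0 < (n : ℝ) / δ := by linarith
  set a := logFactor n δ (4 ^ m) with ha
  have ha0 : 0 ≤ a := logFactor_stage_nonneg hB m
  have haN : a ≤ logFactor n δ N := by
    have hA := le_stage_arg hB m
    have hm0 : (0 : ℝ) ≤ m := m.cast_nonneg
    apply Real.log_le_log
    · have : 0 < 13 * ((n : ℝ) / δ) * (m + 1) := by positivity
      linarith
    · have e : ∀ y : ℝ, 125 * (n : ℝ) * y / δ = n / δ * (125 * y) := fun y => by ring
      rw [e, e]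
      have : Real.log (1.12 * 4 ^ m) ≤ Real.log (1.12 * N) :=
        Real.log_le_log (by positivity) (by linarith)
      exact mul_le_mul_of_nonneg_left (by linarith) hBpos.le
  set x := |(W : ℝ) - N * τ| with hx
  set u := √(N : ℝ) / 2 ^ m with hu
  have hNsq : √(N : ℝ) ^ 2 = N := Real.sq_sqrt hNpos.le
  have h4 : (4 : ℝ) ^ m = (2 ^ m) ^ 2 := by rw [← pow_mul, mul_comm, pow_mul]; norm_num
  have hu1 : 1 ≤ u := by
    rw [hu, one_le_div (by positivity)]
    apply Real.le_sqrt_of_sq_le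
    rw [← h4]; exact hloR
  have hu2 : u ≤ 2 := by
    rw [hu, div_le_iff₀ (by positivity)]
    apply Real.sqrt_le_iff.2 ⟨by positivity, ?_⟩
    rw [mul_pow, ← h4]
    rw [pow_succ] at hhiR
    linarith
  have hxlow : √(N : ℝ) * √a ≤ x := by
    refine le_trans ?_ h.le
    have : (N : ℝ) * confWidth n δ N = √(N : ℝ) * √(logFactor n δ N) := by
      unfold confWidth
      rw [Real.sqrt_div' _ hNpos.le]
      unfold logFactor
      have : (√(N : ℝ)) ≠ 0 := (Real.sqrt_pos.2 hNpos).ne'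
      field_simp
      rw [hNsq, mul_comm]
    rw [this]
    gcongr
  set s := stageSlope n δ m with hs
  have hsu : s * √(N : ℝ) = 2 * u * √a := by
    rw [hs, stageSlope, hu]; ring
  have hs0 : 0 ≤ s := by rw [hs, stageSlope]; positivity
  have key : 0 ≤ -(3 / 2 * a) + s * x - N * s ^ 2 / 8 := by
    have e1 : N * s ^ 2 = 4 * u ^ 2 * a := by
      have : (s * √(N : ℝ)) ^ 2 = (2 * u * √a) ^ 2 := by rw [hsu]
      rw [mul_pow, hNsq, mul_pow, Real.sq_sqrt ha0] at this
      linarith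
    have e2 : 2 * u * a ≤ s * x := by
      calc 2 * u * a = (2 * u * √a) * √a := by rw [mul_assoc (2 * u), Real.mul_self_sqrt ha0]
        _ = s * (√(N : ℝ) * √a) := by rw [← hsu]; ring
        _ ≤ s * x := mul_le_mul_of_nonneg_left hxlow hs0
    rw [e1]
    -- The exponent is at least a(-3/2 + 2u - u²/2) = a(u - 1)(3 - u)/2; this is why the weight has
    -- exponent 3/2.
    have : 0 ≤ a * ((u - 1) * (3 - u)) := by
      apply mul_nonneg ha0
      apply mul_nonneg <;> linarith
    nlinarith
  refine le_trans ?_ (ENNReal.le_tsum m)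
  rcases abs_cases ((W : ℝ) - N * τ) with ⟨h1, -⟩ | ⟨h1, -⟩
  · refine le_trans ?_ le_self_add
    rw [ENNReal.one_le_ofReal, tilt, Real.one_le_exp_iff, ← h1]
    exact key
  · refine le_trans ?_ le_add_self
    rw [ENNReal.one_le_ofReal, tilt, Real.one_le_exp_iff]
    have : -s * ((W : ℝ) - N * τ) = s * x := by rw [hx, h1]; ring
    rw [this, neg_sq]
    exact key

/-! ### A maximal inequality for the history -/

theorem actionExpect_mono (M : ComparisonMatrix n) {f g : Config n L → ℝ≥0∞} {h : History n}
    (h0 : ∀ out, f (h, some out) ≤ g (h, some out))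
    (h1 : ∀ e, f (e :: h, none) ≤ g (e :: h, none)) (a : Action n L) :
    actionExpect M f h a ≤ actionExpect M g h a := by
  cases a with
  | terminate out => exact h0 out
  | compare i j => exact expect_mono fun b _ => h1 _

theorem actionExpect_const (M : ComparisonMatrix n) (c : ℝ≥0∞) (h : History n)
    (a : Action n L) : actionExpect M (fun _ => c) h a = c := by
  cases a with
  | terminate out => rfl
  | compare i j => exact expect_const _ _

/-- Ville's inequality. -/
theorem toOuterMeasure_run_exists_suffix_le (A : RankingAlgorithm n L) (M : ComparisonMatrix n)
    (f : History n → ℝ≥0∞)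
    (hf : ∀ h, expect (A h) (actionExpect M (fun c => f c.1) h) ≤ f h) (t : ℕ) :
    (run A M t).toOuterMeasure {c | ∃ h', h' <:+ c.1 ∧ 1 ≤ f h'} ≤ f [] := by
  classical
  let bad : History n → Prop := fun h => ∃ h', h' <:+ h ∧ 1 ≤ f h'
  -- The process stopped at its first passage above 1 and capped there. Histories grow at the head,
  -- so earlier histories are suffixes.
  let Φ : History n → ℝ≥0∞ := fun h => if bad h then 1 else f h
  have hΦ1 : ∀ h, bad h → Φ h = 1 := fun h hb => if_pos hb
  have hΦ2 : ∀ h, ¬ bad h → Φ h = f h := fun h hb => if_neg hb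
  have hstep : ∀ h, expect (A h) (actionExpect M (fun c => Φ c.1) h) ≤ Φ h := by
    intro h
    by_cases hb : bad h
    · have hb' : ∀ e, bad (e :: h) := fun e => by
        obtain ⟨h', hs, h1⟩ := hb
        exact ⟨h', hs.trans (List.suffix_cons e h), h1⟩
      rw [hΦ1 h hb, ← expect_const (A h) 1]
      refine expect_mono fun a _ => ?_
      rw [← actionExpect_const M 1 h a]
      exact actionExpect_mono M (fun _ => (hΦ1 h hb).le) (fun e => (hΦ1 _ (hb' e)).le) a
    · rw [hΦ2 h hb]
      refine (expect_mono fun a _ => ?_).trans (hf h)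
      refine actionExpect_mono M (fun _ => (hΦ2 h hb).le) (fun e => ?_) a
      by_cases he : bad (e :: h)
      · simp only [hΦ1 _ he]
        obtain ⟨h', hs, h1⟩ := he
        rcases List.suffix_cons_iff.1 hs with rfl | hs
        · exact h1
        · exact absurd ⟨h', hs, h1⟩ hb
      · exact (hΦ2 _ he).le
  have h0 : Φ [] ≤ f [] := by
    by_cases hb : bad []
    · obtain ⟨h', hs, h1⟩ := hb
      rw [List.suffix_nil] at hs
      subst hs
      rwa [hΦ1 _ ⟨[], List.suffix_rfl, h1⟩]
    · exact (hΦ2 _ hb).le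
  rw [← expect_indicator]
  refine (expect_mono fun c _ => ?_).trans
    ((expect_run_le_of_supermartingale A M Φ hstep t).trans h0)
  by_cases hb : bad c.1
  · rw [hΦ1 _ hb]
    split_ifs <;> simp
  · rw [if_neg (show c ∉ {c : Config n L | ∃ h', h' <:+ c.1 ∧ 1 ≤ f h'} from hb)]
    exact zero_le

/-! ### Concentration of the estimated scores -/

/-- The number of comparisons in which `i` was the item under examination. -/
def plays (i : Fin n) (h : History n) : ℕ := h.countP fun e => e.1.1 = i

/-- The number of comparisons won by `i` as the item under examination. -/
def wins (i : Fin n) (h : History n) : ℕ := h.countP fun e => e.1.1 = i ∧ e.2 = true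

theorem plays_cons (i : Fin n) (e : (Fin n × Fin n) × Bool) (h : History n) :
    plays i (e :: h) = plays i h + if e.1.1 = i then 1 else 0 := by
  simp [plays, List.countP_cons]

theorem wins_cons (i : Fin n) (e : (Fin n × Fin n) × Bool) (h : History n) :
    wins i (e :: h) = wins i h + if e.1.1 = i ∧ e.2 = true then 1 else 0 := by
  simp [wins, List.countP_cons]

theorem sum_plays (h : History n) : ∑ i, plays i h = h.length := by
  induction h with
  | nil => simp [plays]
  | cons e h ih => simp [plays_cons, Finset.sum_add_distrib, ih]

/-- The sum over all items of their potentials. -/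
def potential (M : ComparisonMatrix n) (δ : ℝ) (h : History n) : ℝ≥0∞ :=
  ∑ i, itemPotential n δ (score M i) (plays i h) (wins i h)

theorem score_eq_sum_div (hn : 2 ≤ n) (M : ComparisonMatrix n) (i : Fin n) :
    score M i = (∑ j ∈ Finset.univ.erase i, M.prob i j) / (Finset.univ.erase i).card := by
  rw [score, Finset.card_erase_of_mem (Finset.mem_univ i), Finset.card_univ, Fintype.card_fin,
    Nat.cast_sub (by omega)]
  push_cast
  ring

theorem score_mem_of_forall_mem (hn : 2 ≤ n) (M : ComparisonMatrix n) (i : Fin n) {a b : ℝ}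
    (ha : ∀ j, j ≠ i → a ≤ M.prob i j) (hb : ∀ j, j ≠ i → M.prob i j ≤ b) :
    a ≤ score M i ∧ score M i ≤ b := by
  have hc : (0 : ℝ) < (Finset.univ.erase i).card := by
    exact_mod_cast Finset.card_pos.2 (erase_nonempty hn i)
  rw [score_eq_sum_div hn, le_div_iff₀ hc, div_le_iff₀ hc]
  constructor
  · have := Finset.card_nsmul_le_sum (Finset.univ.erase i) (fun j => M.prob i j) a
      fun j hj => ha j (Finset.ne_of_mem_erase hj)
    rw [nsmul_eq_mul] at this
    linarith
  · have := Finset.sum_le_card_nsmul (Finset.univ.erase i) (fun j => M.prob i j) b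
      fun j hj => hb j (Finset.ne_of_mem_erase hj)
    rw [nsmul_eq_mul] at this
    linarith

theorem score_pos (hn : 2 ≤ n) (M : ComparisonMatrix n) (i : Fin n) : 0 < score M i := by
  have hc : (0 : ℝ) < (Finset.univ.erase i).card := by
    exact_mod_cast Finset.card_pos.2 (erase_nonempty hn i)
  rw [score_eq_sum_div hn]
  exact div_pos (Finset.sum_pos (fun j _ => M.prob_pos i j) (erase_nonempty hn i)) hc

theorem score_lt_one (hn : 2 ≤ n) (M : ComparisonMatrix n) (i : Fin n) : score M i < 1 := by
  have hc : (0 : ℝ) < (Finset.univ.erase i).card := by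
    exact_mod_cast Finset.card_pos.2 (erase_nonempty hn i)
  rw [score_eq_sum_div hn, div_lt_one hc]
  calc _ < ∑ j ∈ Finset.univ.erase i, (1 : ℝ) :=
        Finset.sum_lt_sum_of_nonempty (erase_nonempty hn i) fun j _ => M.prob_lt_one i j
    _ = _ := by simp

/-- Against a random opponent, item `i` wins with probability `score M i`. -/
theorem expect_random_opponent (hn : 2 ≤ n) (M : ComparisonMatrix n) (i : Fin n)
    (g : Bool → ℝ≥0∞) :
    expect (PMF.uniformOfFinset (Finset.univ.erase i) (erase_nonempty hn i))
      (fun j => expect (outcome M i j) g) =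
      ENNReal.ofReal (score M i) * g true + ENNReal.ofReal (1 - score M i) * g false := by
  have hc : (0 : ℝ) < (Finset.univ.erase i).card := by
    exact_mod_cast Finset.card_pos.2 (erase_nonempty hn i)
  have key : ∀ q : Fin n → ℝ, (∀ j, 0 ≤ q j) →
      ((Finset.univ.erase i).card : ℝ≥0∞)⁻¹ * ∑ j ∈ Finset.univ.erase i, ENNReal.ofReal (q j) =
      ENNReal.ofReal ((∑ j ∈ Finset.univ.erase i, q j) / (Finset.univ.erase i).card) := by
    intro q hq
    rw [div_eq_inv_mul, ENNReal.ofReal_mul (inv_nonneg.2 hc.le), ENNReal.ofReal_inv_of_pos hc,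
      ENNReal.ofReal_natCast, ENNReal.ofReal_sum_of_nonneg fun j _ => hq j]
  simp_rw [expect_outcome]
  rw [expect_add, expect_mul_const, expect_mul_const, expect_uniformOfFinset,
    expect_uniformOfFinset, key _ fun j => (M.prob_pos i j).le,
    key _ fun j => by linarith [M.prob_lt_one i j], score_eq_sum_div hn]
  congr 3
  rw [Finset.sum_sub_distrib, Finset.sum_const, nsmul_eq_mul, mul_one, sub_div, div_self hc.ne']

/-- Only the summand of the examined item changes. Averaged over the opponent, its trial is
Bernoulli with the score as parameter, and the potential ignores who the opponent was. -/
theorem expect_potential_le (hn : 2 ≤ n) (k : Fin (L + 1) → ℕ) (δ : ℝ) (M : ComparisonMatrix n)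
    (h : History n) :
    expect (activeRanking hn k δ h) (actionExpect M (fun c => potential M δ c.1) h) ≤
      potential M δ h := by
  unfold activeRanking
  split
  · rw [expect_pure]
    rfl
  · rename_i i rest hp
    rw [expect_map]
    simp only [actionExpect]
    set N := plays i h
    set W := wins i h
    set R := ∑ i' ∈ Finset.univ.erase i,
      itemPotential n δ (score M i') (plays i' h) (wins i' h) with hR
    have hsplit : ∀ h' : History n, potential M δ h' =
        itemPotential n δ (score M i) (plays i h') (wins i h') +
        ∑ i' ∈ Finset.univ.erase i,
          itemPotential n δ (score M i') (plays i' h') (wins i' h') := fun h' =>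
      (Finset.add_sum_erase _ _ (Finset.mem_univ i)).symm
    have hcons : ∀ j b, potential M δ (((i, j), b) :: h) =
        itemPotential n δ (score M i) (N + 1) (W + if b = true then 1 else 0) + R := by
      intro j b
      rw [hsplit, plays_cons, wins_cons]
      congr 1
      · simp [N, W]
      · refine Finset.sum_congr rfl fun i' hi' => ?_
        have hne : i ≠ i' := (Finset.ne_of_mem_erase hi').symm
        simp [plays_cons, wins_cons, hne]
    simp_rw [hcons]
    rw [expect_random_opponent hn M i fun b =>
      itemPotential n δ (score M i) (N + 1) (W + if b = true then 1 else 0) + R]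
    simp only [if_true, Bool.false_eq_true, if_false, add_zero]
    have h0 := (score_pos hn M i).le
    have h1 := (score_lt_one hn M i).le
    have hstep := itemPotential_step n δ h0 h1 N W
    rw [hsplit h]
    calc _ = (ENNReal.ofReal (score M i) * itemPotential n δ (score M i) (N + 1) (W + 1) +
          ENNReal.ofReal (1 - score M i) * itemPotential n δ (score M i) (N + 1) W) +
          (ENNReal.ofReal (score M i) + ENNReal.ofReal (1 - score M i)) * R := by ring
      _ ≤ _ := by
        rw [← ENNReal.ofReal_add h0 (sub_nonneg.2 h1)]
        simp only [add_sub_cancel, ENNReal.ofReal_one, one_mul]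
        gcongr

theorem potential_nil_le {δ : ℝ} (hn : 2 ≤ n) (hδ : 0 < δ) (hδ1 : δ ≤ 1)
    (M : ComparisonMatrix n) : potential M δ [] ≤ ENNReal.ofReal δ := by
  have hnR : (2 : ℝ) ≤ n := by exact_mod_cast hn
  have hB : 1 ≤ (n : ℝ) / δ := by rw [one_le_div hδ]; linarith
  unfold potential
  calc _ ≤ ∑ _i : Fin n, ENNReal.ofReal (δ / n) :=
        Finset.sum_le_sum fun i _ => itemPotential_zero_le hB (score M i)
    _ = ENNReal.ofReal δ := by
        rw [← ENNReal.ofReal_sum_of_nonneg fun i _ => by positivity]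
        simp only [Finset.sum_const, Finset.card_univ, Fintype.card_fin, nsmul_eq_mul]
        congr 1
        field_simp

/-- At no time did the potential reach one. -/
def Typical (M : ComparisonMatrix n) (δ : ℝ) (h : History n) : Prop :=
  ∀ h', h' <:+ h → potential M δ h' < 1

theorem ofReal_le_toOuterMeasure_typical {δ : ℝ} (hn : 2 ≤ n) (hδ : 0 < δ) (hδ1 : δ ≤ 1)
    (k : Fin (L + 1) → ℕ) (M : ComparisonMatrix n) (t : ℕ) :
    ENNReal.ofReal (1 - δ) ≤
      (run (activeRanking hn k δ) M t).toOuterMeasure {c | Typical M δ c.1} := by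
  have h1 := toOuterMeasure_run_exists_suffix_le (activeRanking hn k δ) M (potential M δ)
    (expect_potential_le hn k δ M) t
  have h2 := toOuterMeasure_add_compl (run (activeRanking hn k δ) M t)
    {c | ∃ h', h' <:+ c.1 ∧ 1 ≤ potential M δ h'}
  have h3 : {c : Config n L | ∃ h', h' <:+ c.1 ∧ 1 ≤ potential M δ h'}ᶜ =
      {c | Typical M δ c.1} := by
    ext c
    simp [Typical]
  rw [h3] at h2
  rw [ENNReal.ofReal_sub _ hδ.le, ENNReal.ofReal_one, tsub_le_iff_left, ← h2]
  gcongr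
  exact h1.trans (potential_nil_le hn hδ hδ1 M)

theorem Typical.abs_wins_sub_le {M : ComparisonMatrix n} {δ : ℝ} (hB : 1 ≤ (n : ℝ) / δ)
    {h : History n} (ht : Typical M δ h) {i : Fin n} (hp : 1 ≤ plays i h) :
    |(wins i h : ℝ) - plays i h * score M i| ≤ plays i h * confWidth n δ (plays i h) := by
  by_contra! hlt
  have h1 := one_le_itemPotential hB hp hlt
  have h2 := ht h List.suffix_rfl
  have h3 : itemPotential n δ (score M i) (plays i h) (wins i h) ≤ potential M δ h :=
    Finset.single_le_sum (f := fun i => itemPotential n δ (score M i) (plays i h) (wins i h))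
      (fun _ _ => zero_le) (Finset.mem_univ i)
  exact absurd (h1.trans h3) (not_le.2 h2)

/-! ### The course of the AR algorithm -/

/-- The comparisons of the history are those that the AR algorithm asks for. -/
def Consistent (k : Fin (L + 1) → ℕ) (δ : ℝ) (h : History n) : Prop :=
  ∀ e h', e :: h' <:+ h → (arState k δ h').pending.head? = some e.1.1

/-- The memory agrees with the history, and no item `i` survives round `T i`. -/
structure ARState.Tracks (k : Fin (L + 1) → ℕ) (M : ComparisonMatrix n) (T : Fin n → ℕ)
    (s : ARState n L) (h : History n) : Prop where
  round_pos : 1 ≤ s.round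
  pending_subset : ∀ i ∈ s.pending, i ∈ s.active
  pending_nodup : s.pending.Nodup
  plays_pending : ∀ i ∈ s.pending, plays i h + 1 = s.round
  plays_active : ∀ i ∈ s.active, i ∉ s.pending → plays i h = s.round
  scoreEst_eq : ∀ i ∈ s.active, (plays i h : ℝ) * s.scoreEst i = wins i h
  sound : s.Sound k M
  round_le : ∀ i ∈ s.active, s.round ≤ T i
  plays_le : ∀ i, plays i h ≤ T i

theorem card_filter_rank_lt (M : ComparisonMatrix n) {m : ℕ} (hm : m ≤ n) :
    (Finset.univ.filter fun i => rank M i < m).card = m := by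
  have : (Finset.univ.filter fun i => rank M i < m) =
      (Finset.univ.filter fun r : Fin n => (r : ℕ) < m).map (ranking M).toEmbedding := by
    ext i
    simp only [Finset.mem_filter, Finset.mem_univ, true_and, Finset.mem_map_equiv]
    rfl
  rw [this, Finset.card_map, Fin.card_filter_val_lt, min_eq_right hm]

section Course

variable {k : Fin (L + 1) → ℕ} {M : ComparisonMatrix n} {T : Fin n → ℕ}

theorem ARState.tracks_initial (hk : IsBorders n L k) (hT : ∀ i, 1 ≤ T i) :
    (ARState.initial k).Tracks k M T [] where
  round_pos := le_rfl
  pending_subset := fun i _ => Finset.mem_univ i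
  pending_nodup := Finset.sort_nodup Finset.univ (· ≤ ·)
  plays_pending := fun i _ => by simp [plays, initial]
  plays_active := fun i _ hi => absurd (by simp [initial]) hi
  scoreEst_eq := fun i _ => by simp [plays, wins]
  sound := ⟨fun i l => by simp [initial], fun m => by
    simpa [initial] using (card_filter_rank_lt M (hk.border_le m)).symm⟩
  round_le := fun i _ => hT i
  plays_le := fun i => by simp [plays]

/-- The memory after a comparison of the first pending item, before the end of the round. -/
def ARState.advance (s : ARState n L) (i : Fin n) (rest : List (Fin n)) (win : Bool) :
    ARState n L :=
  { s with
    scoreEst := Function.update s.scoreEst i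
      (((s.round : ℝ) - 1) / s.round * s.scoreEst i + if win then 1 / (s.round : ℝ) else 0)
    pending := rest }

/-- The running-mean update is exactly what preserves "plays times estimate equals wins", a form
that also makes sense before the first play. -/
theorem ARState.Tracks.advance {s : ARState n L} {h : History n} (hs : s.Tracks k M T h)
    {i : Fin n} {rest : List (Fin n)} (hp : s.pending = i :: rest) (j : Fin n) (b : Bool) :
    (s.advance i rest b).Tracks k M T (((i, j), b) :: h) := by
  have hi : i ∈ s.pending := by simp [hp]
  have hnd := hs.pending_nodup
  rw [hp, List.nodup_cons] at hnd
  have hplay := hs.plays_pending i hi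
  have hact := hs.pending_subset i hi
  have hother : ∀ i', i ≠ i' → plays i' (((i, j), b) :: h) = plays i' h := fun i' hne => by
    simp [plays_cons, hne]
  have hself : plays i (((i, j), b) :: h) = s.round := by
    simpa [plays_cons] using hplay
  refine ⟨hs.round_pos, ?_, hnd.2, ?_, ?_, ?_, ⟨hs.sound.mem_est, hs.sound.border_eq⟩,
    hs.round_le, ?_⟩
  · intro i' hi'
    exact hs.pending_subset i' (by rw [hp]; exact List.mem_cons_of_mem _ hi')
  · intro i' hi'
    have hne : i ≠ i' := fun h => hnd.1 (h ▸ hi')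
    rw [hother i' hne]
    exact hs.plays_pending i' (by rw [hp]; exact List.mem_cons_of_mem _ hi')
  · intro i' ha hi'
    by_cases hne : i = i'
    · subst hne
      exact hself
    · rw [hother i' hne]
      refine hs.plays_active i' ha ?_
      rw [hp, List.mem_cons, not_or]
      exact ⟨fun h => hne h.symm, hi'⟩
  · intro i' ha
    by_cases hne : i = i'
    · subst hne
      have hr : (s.round : ℝ) ≠ 0 := by
        have := hs.round_pos
        positivity
      have hprev := hs.scoreEst_eq i hact
      have hplayR : (plays i h : ℝ) = s.round - 1 := by
        rw [← hplay]
        push_cast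
        ring
      rw [hself]
      simp only [ARState.advance, Function.update_self]
      rw [mul_add, ← mul_assoc, mul_div_cancel₀ _ hr, ← hplayR, hprev, wins_cons]
      cases b <;> simp [hr]
    · rw [hother i' hne, wins_cons]
      have hupd : (s.advance i rest b).scoreEst i' = s.scoreEst i' :=
        Function.update_of_ne (Ne.symm hne) _ _
      rw [hupd, hs.scoreEst_eq i' ha]
      simp [hne]
  · intro i'
    by_cases hne : i = i'
    · subst hne
      rw [hself]
      exact hs.round_le i hact
    · rw [hother i' hne]
      exact hs.plays_le i'

variable {δ : ℝ}

theorem ARState.Tracks.close (hB : 1 ≤ (n : ℝ) / δ) {s : ARState n L} {h : History n}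
    (hs : s.Tracks k M T h) (ht : Typical M δ h) (hp : s.pending = []) : s.Close M δ := by
  intro i hi
  have hplay : plays i h = s.round := hs.plays_active i hi (by simp [hp])
  have hr := hs.round_pos
  have h1 := ht.abs_wins_sub_le hB (i := i) (by omega)
  have h2 := hs.scoreEst_eq i hi
  rw [← h2, hplay, ← mul_sub, abs_mul] at h1
  have hrpos : (0 : ℝ) < s.round := by exact_mod_cast hr
  rw [abs_of_pos hrpos] at h1
  exact le_of_mul_le_mul_left h1 hrpos

/-- An item still active in round `T i` is removed at the end of that very round, so the width is
never required to be monotone in the round. -/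
theorem ARState.Tracks.endRound (hM : M ∈ comparisonClass n 0) (hk : IsBorders n L k)
    (hT : ∀ i l, i ∈ targetSet k M l → GapsExceed k M (6 * confWidth n δ (T i)) l i)
    {s : ARState n L} {h : History n} (hs : s.Tracks k M T h) (hc : s.Close M δ)
    (hp : s.pending = []) : (s.endRound δ).Tracks k M T h := by
  obtain ⟨h1, h3, h4, h5⟩ := ARState.foldl_classifyItem_spec hM hk (s.active.sort (· ≤ ·))
    hs.sound hc (Finset.sort_nodup _ _) fun j hj => (Finset.mem_sort _).1 hj
  unfold ARState.endRound
  set s' := (s.active.sort (· ≤ ·)).foldl (ARState.classifyItem δ) s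
  have hplay : ∀ i ∈ s'.active, plays i h = s.round := fun i hi =>
    hs.plays_active i (h4 hi) (by simp [hp])
  refine ⟨Nat.le_add_left _ _, ?_, Finset.sort_nodup _ _, ?_, ?_, ?_, ⟨h1.mem_est, h1.border_eq⟩,
    ?_, hs.plays_le⟩
  · intro i hi
    exact (Finset.mem_sort _).1 hi
  · intro i hi
    rw [hplay i ((Finset.mem_sort _).1 hi)]
  · intro i ha hi
    exact absurd ((Finset.mem_sort _).2 ha) hi
  · intro i hi
    change (plays i h : ℝ) * s'.scoreEst i = wins i h
    rw [h3]
    exact hs.scoreEst_eq i (h4 hi)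
  · intro i hi
    have hle := hs.round_le i (h4 hi)
    rcases Nat.lt_or_ge s.round (T i) with hlt | hge
    · exact hlt
    · have he : s.round = T i := le_antisymm hle hge
      obtain ⟨l, hl⟩ := hk.exists_mem_targetSet M i
      exact absurd hi (h5 i ((Finset.mem_sort _).2 (h4 hi)) l hl (by rw [he]; exact hT i l hl))

/-- The memory is computed from the outcomes alone; `Consistent` ties them to the items recorded in
the history. The pending list is rebuilt from the active items whenever a round ends, so it can be
empty only if no item is active. -/
theorem arState_tracks (hB : 1 ≤ (n : ℝ) / δ) (hM : M ∈ comparisonClass n 0)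
    (hk : IsBorders n L k) (hT1 : ∀ i, 1 ≤ T i)
    (hT : ∀ i l, i ∈ targetSet k M l → GapsExceed k M (6 * confWidth n δ (T i)) l i)
    (h : History n) (hcons : Consistent k δ h) (htyp : Typical M δ h) :
    (arState k δ h).Tracks k M T h ∧
      ((arState k δ h).pending = [] → (arState k δ h).active = ∅) := by
  induction h with
  | nil =>
    refine ⟨ARState.tracks_initial hk hT1, fun hp => ?_⟩
    have hp' : (Finset.univ : Finset (Fin n)).sort (· ≤ ·) = [] := hp
    change Finset.univ = ∅
    rw [← Finset.sort_toFinset (Finset.univ : Finset (Fin n)) (· ≤ ·), hp']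
    rfl
  | cons e h ih =>
    obtain ⟨hs, -⟩ := ih (fun e' h' hsuf => hcons e' h' (hsuf.trans (List.suffix_cons e h)))
      (fun h' hsuf => htyp h' (hsuf.trans (List.suffix_cons e h)))
    have hhead := hcons e h List.suffix_rfl
    obtain ⟨⟨i, j⟩, b⟩ := e
    rw [List.head?_eq_some_iff] at hhead
    obtain ⟨rest, hp⟩ := hhead
    have hadv := hs.advance hp j b
    have hrec : arState k δ (((i, j), b) :: h) =
        if rest = [] then ((arState k δ h).advance i rest b).endRound δ
        else (arState k δ h).advance i rest b := by
      rw [arState, ARState.record, hp]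
      rfl
    rw [hrec]
    split_ifs with hrest
    · have hpe : ((arState k δ h).advance i rest b).pending = [] := hrest
      refine ⟨hadv.endRound hM hk hT (hadv.close hB htyp hpe) hpe, fun hp' => ?_⟩
      unfold ARState.endRound at hp' ⊢
      simp only at hp' ⊢
      rw [← Finset.sort_toFinset (List.foldl _ _ _ : ARState n L).active (· ≤ ·), hp']
      rfl
    · exact ⟨hadv, fun hp' => absurd hp' hrest⟩

theorem consistent_of_mem_support_run (hn : 2 ≤ n) (k : Fin (L + 1) → ℕ) (δ : ℝ)
    (M : ComparisonMatrix n) (t : ℕ) :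
    ∀ c ∈ (run (activeRanking hn k δ) M t).support, Consistent k δ c.1 ∧
      (c.2 = none → c.1.length = t) ∧
      ∀ out, c.2 = some out → (arState k δ c.1).pending = [] ∧ out = (arState k δ c.1).est := by
  induction t with
  | zero =>
    intro c hc
    rw [run, PMF.mem_support_pure_iff] at hc
    subst hc
    refine ⟨fun e h' hs => ?_, fun _ => rfl, fun out ho => by simp at ho⟩
    have := hs.length_le
    simp at this
  | succ t ih =>
    intro c hc
    rw [run, PMF.mem_support_bind_iff] at hc
    obtain ⟨⟨h, o⟩, hd, hc⟩ := hc
    obtain ⟨h1, h2, h3⟩ := ih _ hd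
    simp only at h1 h2 h3
    cases o with
    | some out =>
      simp only [step, PMF.mem_support_pure_iff] at hc
      subst hc
      exact ⟨h1, by simp, h3⟩
    | none =>
      simp only [step, PMF.mem_support_bind_iff] at hc
      obtain ⟨a, ha, hc⟩ := hc
      unfold activeRanking at ha
      split at ha
      · rename_i hp
        rw [PMF.mem_support_pure_iff] at ha
        subst ha
        simp only [PMF.mem_support_pure_iff] at hc
        subst hc
        refine ⟨h1, by simp, fun out ho => ?_⟩
        exact ⟨hp, (Option.some.inj ho).symm⟩
      · rename_i i rest hp
        rw [PMF.mem_support_map_iff] at ha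
        obtain ⟨j, -, rfl⟩ := ha
        simp only [PMF.mem_support_map_iff] at hc
        obtain ⟨b, -, rfl⟩ := hc
        refine ⟨?_, fun _ => by simp [h2 rfl], fun out ho => by simp at ho⟩
        intro e h' hs
        rcases List.suffix_cons_iff.1 hs with he | hs
        · obtain ⟨rfl, rfl⟩ := List.cons.inj he
          simp [hp]
        · exact h1 e h' hs

theorem ofReal_le_probTerminates_activeRanking (hn : 2 ≤ n) (hδ : 0 < δ) (hδ1 : δ ≤ 1)
    (hM : M ∈ comparisonClass n 0) (hk : IsBorders n L k) (hT1 : ∀ i, 1 ≤ T i)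
    (hT : ∀ i l, i ∈ targetSet k M l → GapsExceed k M (6 * confWidth n δ (T i)) l i) :
    ENNReal.ofReal (1 - δ) ≤ probTerminates (activeRanking hn k δ) M
      fun h out => out = targetSet k M ∧ h.length ≤ ∑ i, T i := by
  have hnR : (2 : ℝ) ≤ n := by exact_mod_cast hn
  have hB : 1 ≤ (n : ℝ) / δ := by rw [one_le_div hδ]; linarith
  -- A run still going after `∑ i, T i + 1` steps has made that many comparisons, one more than a
  -- typical history allows.
  refine (ofReal_le_toOuterMeasure_typical hn hδ hδ1 k M (∑ i, T i + 1)).trans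
    (le_trans ?_ (le_iSup _ (∑ i, T i + 1)))
  refine PMF.toOuterMeasure_mono _ ?_
  rintro ⟨h, o⟩ ⟨htyp, hsup⟩
  obtain ⟨hcons, hnone, hsome⟩ := consistent_of_mem_support_run hn k δ M _ _ hsup
  obtain ⟨htr, hnil⟩ := arState_tracks hB hM hk hT1 hT h hcons htyp
  have hlen : h.length ≤ ∑ i, T i := by
    rw [← sum_plays]
    exact Finset.sum_le_sum fun i _ => htr.plays_le i
  cases o with
  | none =>
    have : h.length = ∑ i, T i + 1 := hnone rfl
    omega
  | some out =>
    obtain ⟨hp, ho⟩ := hsome out rfl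
    refine ⟨out, rfl, ?_, hlen⟩
    rw [ho]
    funext l
    ext i
    rw [htr.sound.mem_est, hnil hp]
    simp

end Course

/-! ### The number of rounds that resolve a gap -/

/-- The confidence width falls below a sixth of the gap `g` after a number of rounds of the order
`log (n / δ) * fAR g`. -/
theorem exists_round_confWidth_lt {δ g : ℝ} (hn : 2 ≤ n) (hδ : 0 < δ) (hδ' : δ ≤ 0.14)
    (hg : 0 < g) (hg1 : g < 1) :
    ∃ t : ℕ, 1 ≤ t ∧ 6 * confWidth n δ t < g ∧
      (t : ℝ) ≤ 8192 * Real.log (n / δ) * fAR g := by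
  have hnR : (2 : ℝ) ≤ n := by exact_mod_cast hn
  have hl2 := Real.log_two_gt_d9
  have hl2' := Real.log_two_lt_d9
  set B := (n : ℝ) / δ with hBdef
  have hB : 8 ≤ B := by rw [hBdef, le_div_iff₀ hδ]; linarith
  set D := Real.log B with hD
  have hD2 : 2 ≤ D := by
    have h8 : Real.log 8 ≤ D := Real.log_le_log (by norm_num) hB
    have : Real.log 8 = 3 * Real.log 2 := by
      rw [show (8 : ℝ) = 2 ^ 3 by norm_num, Real.log_pow]; norm_num
    linarith
  set X := Real.log (2 / g) with hX
  have hXg : X = Real.log 2 - Real.log g := Real.log_div (by norm_num) hg.ne'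
  have hlogg : Real.log g < 0 := Real.log_neg hg hg1
  have hX0 : 0.69 ≤ X := by linarith
  set Y := Real.log (2 * X) with hY
  have hY0 : 1 / 4 ≤ Y := by
    have h1 := Real.one_sub_inv_le_log_of_pos (x := 2 * X) (by linarith)
    have h2 : (2 * X)⁻¹ ≤ 3 / 4 := by
      rw [inv_le_comm₀ (by linarith) (by norm_num)]
      linarith
    linarith
  have hYX : Y ≤ 2 * X := by
    have := Real.log_le_sub_one_of_pos (x := 2 * X) (by linarith)
    linarith
  set Q := D * Y / g ^ 2 with hQ
  have hg2 : g ^ 2 ≤ 1 := pow_le_one₀ hg.le hg1.le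
  have hg2pos : 0 < g ^ 2 := by positivity
  have hDX2 : 2 * X ≤ D * X := mul_le_mul_of_nonneg_right hD2 (by linarith)
  have hDXD : D * 0.69 ≤ D * X := mul_le_mul_of_nonneg_left hX0 (by linarith)
  have hDY2 : 2 * Y ≤ D * Y := mul_le_mul_of_nonneg_right hD2 (by linarith)
  have hDYD : D * (1 / 4) ≤ D * Y := mul_le_mul_of_nonneg_left hY0 (by linarith)
  have hDY : 1 / 2 ≤ D * Y := by linarith
  have hQg : Q * g ^ 2 = D * Y := div_mul_cancel₀ _ hg2pos.ne'
  have hQ0 : 1 / 2 ≤ Q := by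
    rw [hQ, le_div_iff₀ hg2pos]
    linarith
  -- The factor 4096 exceeds 36 · 25, with 36 = 6² and 25 from `hlog` below. Rounding up at most
  -- doubles the number, since Q ≥ 1/2.
  have hceil := Nat.le_ceil (4096 * Q)
  have hceil' := Nat.ceil_lt_add_one (a := 4096 * Q) (by linarith)
  set t := ⌈4096 * Q⌉₊ with ht
  have ht1 : 1 ≤ t := Nat.one_le_iff_ne_zero.2 fun h => by
    rw [h] at hceil
    norm_num at hceil
    linarith
  have htpos : (0 : ℝ) < t := by exact_mod_cast ht1
  refine ⟨t, ht1, ?_, ?_⟩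
  swap
  · have : 8192 * D * fAR g = 8192 * Q := by
      rw [hQ, fAR]; ring
    rw [this]
    linarith
  -- A bound by a product: the next logarithm turns it into log D + log X, and log X ≤ Y. This is
  -- the source of the iterated logarithm in `fAR`.
  have hlogt : Real.log (1.12 * t) ≤ 14 * (D * X) := by
    have h1 : 1.12 * (t : ℝ) ≤ 2 ^ 14 * Q := by norm_num; linarith
    have h2 : Real.log (1.12 * t) ≤ Real.log (2 ^ 14 * Q) :=
      Real.log_le_log (by positivity) h1
    have h3 : Real.log (2 ^ 14 * Q) =
        14 * Real.log 2 + (Real.log D + Real.log Y - 2 * Real.log g) := by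
      rw [Real.log_mul (by norm_num) (by linarith), Real.log_pow, hQ,
        Real.log_div (by linarith) hg2pos.ne', Real.log_mul (by linarith) (by linarith),
        Real.log_pow]
      norm_num
    have h4 := Real.log_le_sub_one_of_pos (x := D) (by linarith)
    have h5 := Real.log_le_sub_one_of_pos (x := Y) (by linarith)
    rw [h3] at h2
    linarith
  have hlogt0 : 0 < Real.log (1.12 * t) := by
    apply Real.log_pos
    have : (1 : ℝ) ≤ t := by exact_mod_cast ht1
    linarith
  have hlog : Real.log (125 * n * Real.log (1.12 * t) / δ) ≤ 25 * (D * Y) := by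
    have e : 125 * (n : ℝ) * Real.log (1.12 * t) / δ = 125 * (B * Real.log (1.12 * t)) := by
      rw [hBdef]; ring
    rw [e]
    -- 125 · 14 = 1750 is below 2^11.
    have h1 : 125 * (B * Real.log (1.12 * t)) ≤ 2 ^ 11 * (B * (D * X)) := by
      have : B * Real.log (1.12 * t) ≤ B * (14 * (D * X)) :=
        mul_le_mul_of_nonneg_left hlogt (by linarith)
      have h' : 0 ≤ B * (D * X) := by
        exact mul_nonneg (by linarith) (by linarith)
      norm_num
      linarith
    have h2 := Real.log_le_log (by positivity) h1
    have h3 : Real.log (2 ^ 11 * (B * (D * X))) =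
        11 * Real.log 2 + (D + (Real.log D + Real.log X)) := by
      have hD0 : D ≠ 0 := by linarith
      have hX0' : X ≠ 0 := by linarith
      have hB0 : B ≠ 0 := by linarith
      rw [Real.log_mul (by norm_num) (mul_ne_zero hB0 (mul_ne_zero hD0 hX0')),
        Real.log_mul hB0 (mul_ne_zero hD0 hX0'), Real.log_mul hD0 hX0', Real.log_pow,
        ← hD]
      norm_num
    have h4 := Real.log_le_sub_one_of_pos (x := D) (by linarith)
    have h5 : Real.log X ≤ Y := Real.log_le_log (by linarith) (by linarith)
    rw [h3] at h2
    linarith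
  have hmain : confWidth n δ t < g / 6 := by
    unfold confWidth
    rw [Real.sqrt_lt' (by linarith), div_lt_iff₀ htpos]
    have : 4096 * (D * Y) ≤ g ^ 2 * t := by
      have := mul_le_mul_of_nonneg_left hceil hg2pos.le
      linarith
    have e : (g / 6) ^ 2 * t = g ^ 2 * t / 36 := by ring
    rw [e]
    linarith
  linarith

/-! ### The relevant gaps of a single item -/

section Gaps

variable {M : ComparisonMatrix n} (hM : M ∈ comparisonClass n 0) {k : Fin (L + 1) → ℕ}
  (hk : IsBorders n L k) {l : Fin L} {i : Fin n} (hi : i ∈ targetSet k M l)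
include hM hk hi

theorem gapUp_mem (hn : 2 ≤ n) (hl : (l : ℕ) ≠ 0) : 0 < gapUp k M l i ∧ gapUp k M l i < 1 := by
  have hpos := hk.border_pos hl
  obtain ⟨q, hq, hqs⟩ := orderedScore_eq M (r := k l.castSucc)
    (by have := hk.border_le l.castSucc; omega)
  rw [mem_targetSet] at hi
  have hlt : score M i < score M q := (score_lt_score_iff hM).2 (by omega)
  have h1 := score_pos hn M i
  have h2 := score_lt_one hn M q
  rw [gapUp, hqs]
  constructor <;> linarith

theorem gapLo_mem (hn : 2 ≤ n) (hl : (l : ℕ) + 1 ≠ L) :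
    0 < gapLo k M l i ∧ gapLo k M l i < 1 := by
  have hpos := hk.border_lt hl
  obtain ⟨q, hq, hqs⟩ := orderedScore_eq M (r := k l.succ + 1) (by omega)
  rw [mem_targetSet] at hi
  have hlt : score M q < score M i := (score_lt_score_iff hM).2 (by omega)
  have h1 := score_pos hn M q
  have h2 := score_lt_one hn M i
  rw [gapLo, hqs]
  constructor <;> linarith

end Gaps

/-- The contribution of item `i` of the set with index `l` to `gapSum`. -/
def gapTerm (f : ℝ → ℝ) (k : Fin (L + 1) → ℕ) (M : ComparisonMatrix n) (l : Fin L)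
    (i : Fin n) : ℝ :=
  if (l : ℕ) = 0 then f (gapLo k M l i)
  else if (l : ℕ) + 1 = L then f (gapUp k M l i)
  else max (f (gapLo k M l i)) (f (gapUp k M l i))

theorem gapSum_eq_sum_gapTerm {k : Fin (L + 1) → ℕ} (hk : IsBorders n L k)
    (M : ComparisonMatrix n) (f : ℝ → ℝ) {c : Fin n → Fin L}
    (hc : ∀ i, i ∈ targetSet k M (c i)) :
    gapSum f k M = ∑ i, gapTerm f k M (c i) i := by
  have hset : ∀ l, targetSet k M l = Finset.univ.filter fun i => c i = l := by
    intro l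
    ext i
    simp only [Finset.mem_filter, Finset.mem_univ, true_and]
    exact ⟨fun h => hk.targetSet_unique (hc i) h, fun h => h ▸ hc i⟩
  rw [← Finset.sum_fiberwise Finset.univ c]
  refine Finset.sum_congr rfl fun l _ => ?_
  rw [hset]
  refine Finset.sum_congr rfl fun i hi => ?_
  rw [(Finset.mem_filter.1 hi).2]
  rfl

/-- The smallest relevant gap of an item; its `f` is at most the contribution of the item. -/
theorem exists_relevant_gap {M : ComparisonMatrix n} (hn : 2 ≤ n) (hL : 2 ≤ L)
    (hM : M ∈ comparisonClass n 0) {k : Fin (L + 1) → ℕ} (hk : IsBorders n L k) {l : Fin L}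
    {i : Fin n} (hi : i ∈ targetSet k M l) (f : ℝ → ℝ) :
    ∃ g, 0 < g ∧ g < 1 ∧ f g ≤ gapTerm f k M l i ∧ ∀ w, w < g → GapsExceed k M w l i := by
  unfold gapTerm GapsExceed
  by_cases h0 : (l : ℕ) = 0
  · have h1 : (l : ℕ) + 1 ≠ L := by omega
    have hg := gapLo_mem hM hk hi hn h1
    exact ⟨gapLo k M l i, hg.1, hg.2, by rw [if_pos h0], fun w hw => ⟨fun h => absurd h0 h,
      fun _ => hw⟩⟩
  · have hg := gapUp_mem hM hk hi hn h0
    by_cases h1 : (l : ℕ) + 1 = L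
    · exact ⟨gapUp k M l i, hg.1, hg.2, by rw [if_neg h0, if_pos h1], fun w hw => ⟨fun _ => hw,
        fun h => absurd h1 h⟩⟩
    · have hg' := gapLo_mem hM hk hi hn h1
      rw [if_neg h0, if_neg h1]
      refine ⟨min (gapLo k M l i) (gapUp k M l i), lt_min hg'.1 hg.1,
        (min_le_left _ _).trans_lt hg'.2, ?_, fun w hw => ⟨fun _ => (lt_min_iff.1 hw).2,
          fun _ => (lt_min_iff.1 hw).1⟩⟩
      rcases min_choice (gapLo k M l i) (gapUp k M l i) with h | h <;> rw [h]
      · exact le_max_left _ _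
      · exact le_max_right _ _

theorem probTerminates_mono {A : RankingAlgorithm n L} {M : ComparisonMatrix n}
    {Q Q' : History n → Output n L → Prop} (h : ∀ h out, Q h out → Q' h out) :
    probTerminates A M Q ≤ probTerminates A M Q' := by
  refine iSup_mono fun t => MeasureTheory.measure_mono ?_
  rintro c ⟨out, ho, hq⟩
  exact ⟨out, ho, h _ _ hq⟩

theorem activeRanking_upper_bound (hn : 2 ≤ n) (hL : 2 ≤ L) {k : Fin (L + 1) → ℕ}
    (hk : IsBorders n L k) {δ : ℝ} (hδ : 0 < δ) (hδ' : δ ≤ 0.14) {M : ComparisonMatrix n}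
    (hM : M ∈ comparisonClass n 0) :
    ENNReal.ofReal (1 - δ) ≤
      probTerminates (activeRanking hn k δ) M fun h out =>
        out = targetSet k M ∧ (h.length : ℝ) ≤ 8192 * Real.log (n / δ) * gapSum fAR k M := by
  choose c hc using hk.exists_mem_targetSet M
  have hnR : (2 : ℝ) ≤ n := by exact_mod_cast hn
  have hD : 0 ≤ Real.log (n / δ) := by
    apply Real.log_nonneg
    rw [one_le_div hδ]
    linarith
  have hex : ∀ i, ∃ t : ℕ, 1 ≤ t ∧ GapsExceed k M (6 * confWidth n δ t) (c i) i ∧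
      (t : ℝ) ≤ 8192 * Real.log (n / δ) * gapTerm fAR k M (c i) i := by
    intro i
    obtain ⟨g, hg0, hg1, hgf, hgw⟩ := exists_relevant_gap hn hL hM hk (hc i) fAR
    obtain ⟨t, ht1, htw, htb⟩ := exists_round_confWidth_lt hn hδ hδ' hg0 hg1
    exact ⟨t, ht1, hgw _ htw, htb.trans (mul_le_mul_of_nonneg_left hgf (by positivity))⟩
  choose T hT1 hT2 hT3 using hex
  refine (ofReal_le_probTerminates_activeRanking hn hδ (by linarith) hM hk hT1 ?_).trans
    (probTerminates_mono ?_)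
  · intro i l hl
    rw [hk.targetSet_unique hl (hc i)]
    exact hT2 i
  · rintro h out ⟨h1, h2⟩
    refine ⟨h1, ?_⟩
    rw [gapSum_eq_sum_gapTerm hk M fAR hc, Finset.mul_sum]
    calc (h.length : ℝ) ≤ ((∑ i, T i : ℕ) : ℝ) := by exact_mod_cast h2
      _ = ∑ i, (T i : ℝ) := by push_cast; rfl
      _ ≤ _ := Finset.sum_le_sum fun i _ => hT3 i

/-! ### Change of measure -/

/-- The likelihood ratio of `M'` and `M` for one comparison. -/
def likelihoodRatio (M M' : ComparisonMatrix n) (e : (Fin n × Fin n) × Bool) : ℝ :=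
  if e.2 then M'.prob e.1.1 e.1.2 / M.prob e.1.1 e.1.2
  else (1 - M'.prob e.1.1 e.1.2) / (1 - M.prob e.1.1 e.1.2)

/-- The likelihood ratio of `M'` and `M` for a history. -/
def likelihood (M M' : ComparisonMatrix n) (h : History n) : ℝ :=
  (h.map (likelihoodRatio M M')).prod

theorem likelihoodRatio_pos (M M' : ComparisonMatrix n) (e : (Fin n × Fin n) × Bool) :
    0 < likelihoodRatio M M' e := by
  unfold likelihoodRatio
  split_ifs
  · exact div_pos (M'.prob_pos _ _) (M.prob_pos _ _)
  · exact div_pos (sub_pos.2 (M'.prob_lt_one _ _)) (sub_pos.2 (M.prob_lt_one _ _))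

theorem likelihood_pos (M M' : ComparisonMatrix n) (h : History n) : 0 < likelihood M M' h := by
  induction h with
  | nil => simp [likelihood]
  | cons e h ih =>
    rw [likelihood, List.map_cons, List.prod_cons]
    exact mul_pos (likelihoodRatio_pos M M' e) ih

theorem expect_outcome_likelihoodRatio (M M' : ComparisonMatrix n) (i j : Fin n)
    (g : Bool → ℝ≥0∞) :
    expect (outcome M i j) (fun b => ENNReal.ofReal (likelihoodRatio M M' ((i, j), b)) * g b) =
      expect (outcome M' i j) g := by
  have h1 := M.prob_pos i j
  have h2 := sub_pos.2 (M.prob_lt_one i j)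
  rw [expect_outcome, expect_outcome, ← mul_assoc, ← mul_assoc, ← ENNReal.ofReal_mul h1.le,
    ← ENNReal.ofReal_mul h2.le]
  simp only [likelihoodRatio, if_true, Bool.false_eq_true, if_false]
  rw [mul_div_cancel₀ _ h1.ne', mul_div_cancel₀ _ h2.ne']

/-- Given the history, the algorithm acts with the same law under both matrices, so its own
randomness cancels and only outcomes contribute to the density. -/
theorem expect_run_change_of_measure (A : RankingAlgorithm n L) (M M' : ComparisonMatrix n)
    (t : ℕ) (f : Config n L → ℝ≥0∞) :
    expect (run A M' t) f =
      expect (run A M t) fun c => ENNReal.ofReal (likelihood M M' c.1) * f c := by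
  induction t generalizing f with
  | zero => simp [expect_run_zero, likelihood]
  | succ t ih =>
    rw [expect_run_succ, expect_run_succ, ih]
    refine expect_congr fun c _ => ?_
    obtain ⟨h, _ | out⟩ := c
    · rw [expect_step_none, expect_step_none, ← expect_const_mul]
      refine expect_congr fun a _ => ?_
      cases a with
      | terminate out => rfl
      | compare i j =>
        simp only [actionExpect]
        rw [← expect_outcome_likelihoodRatio M M', ← expect_const_mul]
        refine expect_congr fun b _ => ?_
        rw [likelihood, likelihood, List.map_cons, List.prod_cons,
          ENNReal.ofReal_mul (likelihoodRatio_pos M M' _).le]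
        ring
    · rw [expect_step_some, expect_step_some]

/-! ### Additive functionals of the history -/

/-- The sum of `φ` over the comparisons of a history. -/
def historySum (φ : (Fin n × Fin n) × Bool → ℝ≥0∞) (h : History n) : ℝ≥0∞ := (h.map φ).sum

/-- The expected increment of `historySum φ` in the next step. -/
def expectedIncrement (A : RankingAlgorithm n L) (M : ComparisonMatrix n)
    (φ : (Fin n × Fin n) × Bool → ℝ≥0∞) : Config n L → ℝ≥0∞
  | (_, some _) => 0
  | (h, none) => expect (A h) fun
    | .terminate _ => 0
    | .compare i j => expect (outcome M i j) fun b => φ ((i, j), b)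

theorem expect_step_historySum (A : RankingAlgorithm n L) (M : ComparisonMatrix n)
    (φ : (Fin n × Fin n) × Bool → ℝ≥0∞) (c : Config n L) :
    expect (step A M c) (fun c => historySum φ c.1) =
      historySum φ c.1 + expectedIncrement A M φ c := by
  obtain ⟨h, _ | out⟩ := c
  · rw [expect_step_none, expectedIncrement, ← expect_const (A h) (historySum φ h), ← expect_add]
    refine expect_congr fun a _ => ?_
    cases a with
    | terminate out => simp [actionExpect]
    | compare i j =>
      simp only [actionExpect]
      rw [← expect_const (outcome M i j) (historySum φ h), ← expect_add]
      refine expect_congr fun b _ => ?_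
      simp [historySum, add_comm]
  · simp [expect_step_some, expectedIncrement]

/-- Inequalities between mean increments per comparison add up over the adaptively chosen
comparisons. This takes the place of Wald's identity. -/
theorem expect_run_historySum_mono (A : RankingAlgorithm n L) (M : ComparisonMatrix n)
    {φ ψ : (Fin n × Fin n) × Bool → ℝ≥0∞}
    (hφψ : ∀ i j, expect (outcome M i j) (fun b => φ ((i, j), b)) ≤
      expect (outcome M i j) fun b => ψ ((i, j), b)) (t : ℕ) :
    expect (run A M t) (fun c => historySum φ c.1) ≤
      expect (run A M t) fun c => historySum ψ c.1 := by
  induction t with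
  | zero => simp [expect_run_zero, historySum]
  | succ t ih =>
    rw [expect_run_succ, expect_run_succ]
    simp_rw [expect_step_historySum]
    rw [expect_add, expect_add]
    refine add_le_add ih (expect_mono fun c _ => ?_)
    obtain ⟨h, _ | out⟩ := c
    · refine expect_mono fun a _ => ?_
      cases a with
      | terminate out => exact le_rfl
      | compare i j => exact hφψ i j
    · exact le_rfl

/-- The number of comparisons in which item `i` took part. -/
def involved (i : Fin n) (h : History n) : ℕ := h.countP fun e => e.1.1 = i ∨ e.1.2 = i

theorem involved_cons (i : Fin n) (e : (Fin n × Fin n) × Bool) (h : History n) :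
    involved i (e :: h) = involved i h + if e.1.1 = i ∨ e.1.2 = i then 1 else 0 := by
  simp [involved, List.countP_cons]

theorem sum_involved_le (h : History n) : ∑ i, involved i h ≤ 2 * h.length := by
  induction h with
  | nil => simp [involved]
  | cons e h ih =>
    simp only [involved_cons, Finset.sum_add_distrib, List.length_cons]
    have h1 : ∑ i, (if e.1.1 = i ∨ e.1.2 = i then 1 else 0) ≤
        ∑ i, ((if e.1.1 = i then 1 else 0) + if e.1.2 = i then 1 else 0) := by
      refine Finset.sum_le_sum fun i _ => ?_
      by_cases h1 : e.1.1 = i <;> by_cases h2 : e.1.2 = i <;> simp [h1, h2]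
    rw [Finset.sum_add_distrib] at h1
    simp only [Finset.sum_ite_eq, Finset.mem_univ, if_true] at h1
    omega

theorem historySum_involved (i : Fin n) (d : ℝ≥0∞) (h : History n) :
    historySum (fun e => 2 + if e.1.1 = i ∨ e.1.2 = i then d else 0) h =
      2 * h.length + d * involved i h := by
  induction h with
  | nil => simp [historySum, involved]
  | cons e h ih =>
    rw [historySum, List.map_cons, List.sum_cons, ← historySum, ih, involved_cons,
      List.length_cons]
    push_cast
    split_ifs <;> ring

/-- Adding 2 per comparison keeps every summand nonnegative, as log r ≤ r - 1 ≤ 2, so that extended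
nonnegative expectations apply; the surplus is cancelled later. -/
theorem historySum_log_likelihoodRatio {M M' : ComparisonMatrix n}
    (hr : ∀ e, likelihoodRatio M M' e ≤ 3) (h : History n) :
    historySum (fun e => ENNReal.ofReal (2 - Real.log (likelihoodRatio M M' e))) h =
      ENNReal.ofReal (2 * h.length - Real.log (likelihood M M' h)) ∧
    0 ≤ 2 * h.length - Real.log (likelihood M M' h) := by
  induction h with
  | nil => simp [historySum, likelihood]
  | cons e h ih =>
    have h1 : 0 ≤ 2 - Real.log (likelihoodRatio M M' e) := by
      have := Real.log_le_sub_one_of_pos (likelihoodRatio_pos M M' e)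
      linarith [hr e]
    have h2 : 2 * ((e :: h).length : ℝ) - Real.log (likelihood M M' (e :: h)) =
        (2 - Real.log (likelihoodRatio M M' e)) +
          (2 * h.length - Real.log (likelihood M M' h)) := by
      rw [likelihood, List.map_cons, List.prod_cons, ← likelihood,
        Real.log_mul (likelihoodRatio_pos M M' e).ne' (likelihood_pos M M' h).ne',
        List.length_cons]
      push_cast
      ring
    rw [h2]
    refine ⟨?_, add_nonneg h1 ih.2⟩
    rw [historySum, List.map_cons, List.sum_cons, ← historySum, ih.1,
      ENNReal.ofReal_add h1 ih.2]

/-- If an event is likely under `M` and unlikely under `M'`, then the items in which the two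
matrices differ have been compared often. -/
theorem log_mul_toOuterMeasure_le {A : RankingAlgorithm n L} {M M' : ComparisonMatrix n}
    (hr : ∀ e, likelihoodRatio M M' e ≤ 3) {i : Fin n} {d : ℝ≥0∞}
    (hd : ∀ a b, expect (outcome M a b)
      (fun r => ENNReal.ofReal (2 - Real.log (likelihoodRatio M M' ((a, b), r)))) ≤
      2 + if a = i ∨ b = i then d else 0)
    (t : ℕ) (E : Set (Config n L)) {c : ℝ} (hc : 1 ≤ c) :
    ENNReal.ofReal (Real.log c) * (run A M t).toOuterMeasure E ≤
      d * expect (run A M t) (fun c => (involved i c.1 : ℝ≥0∞)) +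
        ENNReal.ofReal c * (run A M' t).toOuterMeasure E := by
  classical
  set P := run A M t with hP
  set len := expect P fun c => 2 * (c.1.length : ℝ≥0∞) with hlen
  -- Finiteness at the fixed time `t` is what permits cancelling the surplus of 2 per comparison.
  have hlen_top : len ≠ ∞ := by
    refine ne_top_of_le_ne_top (b := 2 * (t : ℝ≥0∞)) (ENNReal.mul_ne_top (by simp) (by simp)) ?_
    rw [← expect_const P (2 * (t : ℝ≥0∞))]
    refine expect_mono fun x hx => ?_
    have := length_le_of_mem_support_run A M t x hx
    gcongr
  have hlog := Real.log_nonneg hc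
  -- This is log z ≤ z - 1 with z = ℓc on `E` and z = ℓ off `E`. Its expectation is a variational
  -- bound on the relative entropy, with the density ℓ carrying the right side over to `M'`.
  have hpoint : ∀ x : Config n L,
      2 * (x.1.length : ℝ≥0∞) + (1 + ENNReal.ofReal (Real.log c) * if x ∈ E then 1 else 0) ≤
      historySum (fun e => ENNReal.ofReal (2 - Real.log (likelihoodRatio M M' e))) x.1 +
        ENNReal.ofReal (likelihood M M' x.1) *
          (1 + ENNReal.ofReal (c - 1) * if x ∈ E then 1 else 0) := by
    intro x
    obtain ⟨h1, h2⟩ := historySum_log_likelihoodRatio hr x.1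
    have hl := likelihood_pos M M' x.1
    rw [h1]
    set ℓ := likelihood M M' x.1
    have e0 : 2 * (x.1.length : ℝ≥0∞) = ENNReal.ofReal (2 * x.1.length) := by
      rw [ENNReal.ofReal_mul (by norm_num)]
      simp
    rw [e0]
    by_cases hx : x ∈ E
    · simp only [hx, if_true, mul_one]
      rw [← ENNReal.ofReal_one, ← ENNReal.ofReal_add zero_le_one hlog,
        ← ENNReal.ofReal_add (by positivity) (by positivity),
        ← ENNReal.ofReal_add zero_le_one (by linarith), ← ENNReal.ofReal_mul hl.le,
        ← ENNReal.ofReal_add h2 (mul_nonneg hl.le (by linarith))]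
      refine ENNReal.ofReal_le_ofReal ?_
      have := Real.log_le_sub_one_of_pos (x := ℓ * c) (by positivity)
      rw [Real.log_mul hl.ne' (by linarith)] at this
      linarith
    · simp only [hx, if_false, mul_zero, add_zero, mul_one]
      rw [← ENNReal.ofReal_one, ← ENNReal.ofReal_add (by positivity) zero_le_one,
        ← ENNReal.ofReal_add h2 hl.le]
      refine ENNReal.ofReal_le_ofReal ?_
      have := Real.log_le_sub_one_of_pos hl
      linarith
  have hsum := expect_mono (p := P) fun x _ => hpoint x
  rw [expect_add, expect_add, expect_add, expect_const,
    expect_const_mul P (ENNReal.ofReal (Real.log c)), expect_indicator,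
    ← expect_run_change_of_measure, expect_add, expect_const,
    expect_const_mul _ (ENNReal.ofReal (c - 1)), expect_indicator, ← hlen] at hsum
  have hinc : expect P (fun x => historySum
      (fun e => ENNReal.ofReal (2 - Real.log (likelihoodRatio M M' e))) x.1) ≤
      len + d * expect P (fun c => (involved i c.1 : ℝ≥0∞)) := by
    refine (expect_run_historySum_mono A M
      (ψ := fun e => 2 + if e.1.1 = i ∨ e.1.2 = i then d else 0) (fun a b => ?_) t).trans ?_
    · exact (hd a b).trans (expect_const _ _).ge
    · simp_rw [historySum_involved]
      rw [expect_add, expect_const_mul P d]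
  have hfin := hsum.trans (add_le_add_left hinc _)
  rw [add_assoc len, ENNReal.add_le_add_iff_left hlen_top, ← add_assoc, add_comm _ (1 : ℝ≥0∞),
    add_assoc (1 : ℝ≥0∞), ENNReal.add_le_add_iff_left ENNReal.one_ne_top] at hfin
  refine hfin.trans ?_
  gcongr
  linarith

/-! ### Perturbed comparison matrices -/

theorem comparisonClass_anti {p q : ℝ} (h : p ≤ q) : comparisonClass n q ⊆ comparisonClass n p :=
  fun _ hM => ⟨fun i j => h.trans (hM.1 i j), hM.2⟩

theorem prob_le_of_mem_comparisonClass {p : ℝ} {M : ComparisonMatrix n}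
    (hM : M ∈ comparisonClass n p) (i j : Fin n) : M.prob i j ≤ 1 - p := by
  have h1 := hM.1 j i
  have h2 := M.prob_add_swap i j
  linarith

/-- The change of the matrix entries when item `i` becomes stronger by `x`. -/
def shiftEntry (i : Fin n) (x : ℝ) (a b : Fin n) : ℝ :=
  (if a = i then x else 0) - if b = i then x else 0

theorem abs_shiftEntry_le (i : Fin n) (x : ℝ) (a b : Fin n) : |shiftEntry i x a b| ≤ |x| := by
  unfold shiftEntry
  split_ifs <;> simp

/-- The matrix in which item `i` wins every comparison with an additional probability `x`. -/
def shift {M : ComparisonMatrix n} (hM : M ∈ comparisonClass n (3 / 8)) (i : Fin n) {x : ℝ}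
    (hx : |x| ≤ 1 / 4) : ComparisonMatrix n where
  prob a b := M.prob a b + shiftEntry i x a b
  prob_pos a b := by
    have h1 := hM.1 a b
    have h2 := abs_le.1 ((abs_shiftEntry_le i x a b).trans hx)
    linarith
  prob_lt_one a b := by
    have h1 := prob_le_of_mem_comparisonClass hM a b
    have h2 := abs_le.1 ((abs_shiftEntry_le i x a b).trans hx)
    linarith
  prob_add_swap a b := by
    have := M.prob_add_swap a b
    unfold shiftEntry
    linarith

section Shift

variable {M : ComparisonMatrix n} (hM : M ∈ comparisonClass n (3 / 8)) (i : Fin n) {x : ℝ}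
  (hx : |x| ≤ 1 / 4)

theorem shift_prob (a b : Fin n) :
    (shift hM i hx).prob a b = M.prob a b + shiftEntry i x a b := rfl

theorem score_shift_self (hn : 2 ≤ n) : score (shift hM i hx) i = score M i + x := by
  have hc : (0 : ℝ) < (Finset.univ.erase i).card := by
    exact_mod_cast Finset.card_pos.2 (erase_nonempty hn i)
  rw [score_eq_sum_div hn, score_eq_sum_div hn]
  have : ∑ j ∈ Finset.univ.erase i, (shift hM i hx).prob i j =
      ∑ j ∈ Finset.univ.erase i, (M.prob i j + x) :=
    Finset.sum_congr rfl fun j hj => by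
      simp [shift_prob, shiftEntry, Finset.ne_of_mem_erase hj]
  rw [this, Finset.sum_add_distrib, Finset.sum_const, nsmul_eq_mul]
  field_simp

/-- Exactly one of the n - 1 opponents of `a` is `i`, and only that entry changes. -/
theorem score_shift_of_ne {a : Fin n} (ha : a ≠ i) :
    score (shift hM i hx) a = score M a - x / ((n : ℝ) - 1) := by
  have : ∑ j ∈ Finset.univ.erase a, (shift hM i hx).prob a j =
      ∑ j ∈ Finset.univ.erase a, M.prob a j - x := by
    simp only [shift_prob, shiftEntry, ha, if_false, zero_sub]
    rw [Finset.sum_add_distrib, Finset.sum_neg_distrib, Finset.sum_ite_eq',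
      if_pos (Finset.mem_erase.2 ⟨ha.symm, Finset.mem_univ i⟩), sub_eq_add_neg]
  rw [score, score, this]
  ring

/-- All items other than `i` are translated by the same amount, so new ties can only involve `i`.
The entries lose at most 1/4 from 3/8. -/
theorem shift_mem_comparisonClass (hn : 2 ≤ n)
    (hgen : ∀ a, a ≠ i → score M i + x ≠ score M a - x / ((n : ℝ) - 1)) :
    shift hM i hx ∈ comparisonClass n (1 / 8) := by
  refine ⟨fun a b => ?_, fun a b hab => ?_⟩
  · have h1 := hM.1 a b
    have h2 := abs_le.1 ((abs_shiftEntry_le i x a b).trans hx)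
    rw [shift_prob]
    linarith
  · by_cases ha : a = i
    · subst ha
      rw [score_shift_self hM a hx hn, score_shift_of_ne hM a hx hab.symm]
      exact hgen b hab.symm
    · by_cases hb : b = i
      · subst hb
        rw [score_shift_self hM b hx hn, score_shift_of_ne hM b hx hab]
        exact (hgen a hab).symm
      · rw [score_shift_of_ne hM i hx ha, score_shift_of_ne hM i hx hb]
        intro h
        exact hM.2 a b hab (by linarith)

theorem likelihoodRatio_shift_le (e : (Fin n × Fin n) × Bool) :
    likelihoodRatio M (shift hM i hx) e ≤ 3 := by
  have h1 := hM.1 e.1.1 e.1.2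
  have h2 := prob_le_of_mem_comparisonClass hM e.1.1 e.1.2
  have h3 := abs_le.1 ((abs_shiftEntry_le i x e.1.1 e.1.2).trans hx)
  unfold likelihoodRatio
  rw [shift_prob]
  split_ifs
  · rw [div_le_iff₀ (by linarith)]
    linarith
  · rw [div_le_iff₀ (by linarith)]
    linarith

/-- The relative entropy of two Bernoulli distributions is at most the `χ²`-divergence. -/
theorem bernoulli_log_ratio_le {p q : ℝ} (hp0 : 0 < p) (hp1 : p < 1) (hq0 : 0 < q) (hq1 : q < 1) :
    p * (2 - Real.log (q / p)) + (1 - p) * (2 - Real.log ((1 - q) / (1 - p))) ≤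
      2 + (p - q) ^ 2 / (q * (1 - q)) := by
  have hp1' := sub_pos.2 hp1
  have hq1' := sub_pos.2 hq1
  have h1 : -Real.log (q / p) ≤ p / q - 1 := by
    rw [← Real.log_inv, inv_div]
    exact Real.log_le_sub_one_of_pos (by positivity)
  have h2 : -Real.log ((1 - q) / (1 - p)) ≤ (1 - p) / (1 - q) - 1 := by
    rw [← Real.log_inv, inv_div]
    exact Real.log_le_sub_one_of_pos (by positivity)
  have h3 := mul_le_mul_of_nonneg_left h1 hp0.le
  have h4 := mul_le_mul_of_nonneg_left h2 hp1'.le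
  have e : (p - q) ^ 2 / (q * (1 - q)) =
      p * (p / q - 1) + (1 - p) * ((1 - p) / (1 - q) - 1) := by
    field_simp
    ring
  rw [e]
  linarith

theorem expect_outcome_log_likelihoodRatio_shift (a b : Fin n) :
    expect (outcome M a b) (fun r => ENNReal.ofReal
      (2 - Real.log (likelihoodRatio M (shift hM i hx) ((a, b), r)))) ≤
      2 + if a = i ∨ b = i then ENNReal.ofReal (10 * x ^ 2) else 0 := by
  have hp0 := M.prob_pos a b
  have hp1 := M.prob_lt_one a b
  have hq0 := (shift hM i hx).prob_pos a b
  have hq1 := (shift hM i hx).prob_lt_one a b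
  have hr : ∀ e, 0 ≤ 2 - Real.log (likelihoodRatio M (shift hM i hx) e) := fun e => by
    have h1 := Real.log_le_sub_one_of_pos (likelihoodRatio_pos M (shift hM i hx) e)
    linarith [likelihoodRatio_shift_le hM i hx e]
  have hkl := bernoulli_log_ratio_le hp0 hp1 hq0 hq1
  rw [expect_outcome, ← ENNReal.ofReal_mul hp0.le, ← ENNReal.ofReal_mul (sub_pos.2 hp1).le,
    ← ENNReal.ofReal_add (mul_nonneg hp0.le (hr _)) (mul_nonneg (sub_pos.2 hp1).le (hr _))]
  have hrhs : (2 + if a = i ∨ b = i then ENNReal.ofReal (10 * x ^ 2) else 0) =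
      ENNReal.ofReal (2 + if a = i ∨ b = i then 10 * x ^ 2 else 0) := by
    rw [ENNReal.ofReal_add (by norm_num) (by split_ifs <;> positivity)]
    split_ifs <;> simp
  rw [hrhs]
  refine ENNReal.ofReal_le_ofReal ?_
  simp only [likelihoodRatio, if_true, Bool.false_eq_true, if_false]
  refine hkl.trans ?_
  have hm1 := hM.1 a b
  have hm2 := prob_le_of_mem_comparisonClass hM a b
  have hm3 := abs_le.1 ((abs_shiftEntry_le i x a b).trans hx)
  have hdiff : M.prob a b - (shift hM i hx).prob a b = -shiftEntry i x a b := by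
    rw [shift_prob]; ring
  -- The shifted entry lies in [1/8, 7/8], so the product is at least 7/64.
  have hq : 1 / 10 ≤ (shift hM i hx).prob a b * (1 - (shift hM i hx).prob a b) := by
    rw [shift_prob]
    nlinarith
  rw [hdiff, neg_sq]
  refine add_le_add le_rfl ?_
  rw [div_le_iff₀ (by linarith)]
  split_ifs with hab
  · have : shiftEntry i x a b ^ 2 ≤ x ^ 2 := sq_le_sq.2 (abs_shiftEntry_le i x a b)
    nlinarith [sq_nonneg x]
  · have : shiftEntry i x a b = 0 := by
      rw [not_or] at hab
      simp [shiftEntry, hab.1, hab.2]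
    rw [this]
    simp

/-- Relative to the others, item `i` moves by rs with r = n/(n-1) > 1. Hence any s in (g/r, g)
closes the gap, and only finitely many of these create a tie. -/
theorem exists_generic_shift (hn : 2 ≤ n) {g σ : ℝ} (hg : 0 < g) (hσ : σ = 1 ∨ σ = -1) :
    ∃ s, g < s + s / ((n : ℝ) - 1) ∧ 0 < s ∧ s < g ∧
      ∀ a, a ≠ i → score M i + σ * s ≠ score M a - σ * s / ((n : ℝ) - 1) := by
  have hn1 : (0 : ℝ) < (n : ℝ) - 1 := by
    have : (2 : ℝ) ≤ n := by exact_mod_cast hn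
    linarith
  set r : ℝ := 1 + 1 / ((n : ℝ) - 1) with hr
  have hr1 : 1 < r := by
    have : 0 < 1 / ((n : ℝ) - 1) := by positivity
    linarith
  have hinf := Set.Ioo_infinite (a := g / r) (b := g) (by
    rw [div_lt_iff₀ (by linarith)]; nlinarith)
  obtain ⟨s, ⟨hs1, hs2⟩, hs3⟩ := (hinf.sdiff
    (Set.finite_range fun a => (score M a - score M i) / (σ * r))).nonempty
  have hs0 : 0 < s := lt_trans (by positivity) hs1
  rw [div_lt_iff₀ (by linarith)] at hs1
  refine ⟨s, ?_, hs0, hs2, fun a _ heq => hs3 ⟨a, ?_⟩⟩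
  · calc g < s * r := hs1
      _ = s + s / ((n : ℝ) - 1) := by rw [hr]; ring
  · have hσ0 : σ ≠ 0 := by rcases hσ with rfl | rfl <;> norm_num
    have hr0 : r ≠ 0 := by linarith
    simp only
    rw [div_eq_iff (mul_ne_zero hσ0 hr0), hr]
    linear_combination -heq

end Shift

/-! ### Leaving a target set by crossing a border -/

section TargetChange

variable {M M' : ComparisonMatrix n} {k : Fin (L + 1) → ℕ} {l : Fin L} {i : Fin n}

/-- Of the `k l.succ + 1` items of zero-based rank at most `k l.succ`, at least `k l.succ` differ
from `i` and are now ahead of it, which puts `i` behind the set. -/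
theorem notMem_targetSet_of_overtaken (hM' : M' ∈ comparisonClass n 0) (hk : IsBorders n L k)
    (hl : (l : ℕ) + 1 ≠ L)
    (h : ∀ a, a ≠ i → rank M a ≤ k l.succ → score M' i < score M' a) :
    i ∉ targetSet k M' l := by
  intro hi
  have hlt := (mem_targetSet.1 hi).2
  have hkn := hk.border_lt hl
  have hsub : (Finset.univ.filter fun a => rank M a < k l.succ + 1).erase i ⊆
      Finset.univ.filter fun a => rank M' a < rank M' i := by
    intro a ha
    rw [Finset.mem_erase, Finset.mem_filter] at ha
    rw [Finset.mem_filter]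
    exact ⟨Finset.mem_univ a,
      (score_lt_score_iff hM').1 (h a ha.1 (Nat.lt_succ_iff.1 ha.2.2))⟩
  have hcard := Finset.card_le_card hsub
  rw [card_filter_rank_lt M' (rank_lt M' i).le] at hcard
  have h2 := Finset.pred_card_le_card_erase
    (s := Finset.univ.filter fun a => rank M a < k l.succ + 1) (a := i)
  rw [card_filter_rank_lt M hkn] at h2
  omega

/-- Besides `i`, only the `k l.castSucc - 1` foremost items can still be ahead of it, which leaves
`i` a place in front of the set. -/
theorem notMem_targetSet_of_overtaking (hM' : M' ∈ comparisonClass n 0) (hk : IsBorders n L k)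
    (hl : (l : ℕ) ≠ 0)
    (h : ∀ a, a ≠ i → k l.castSucc ≤ rank M a + 1 → score M' a < score M' i) :
    i ∉ targetSet k M' l := by
  intro hi
  have hge := (mem_targetSet.1 hi).1
  have hkpos := hk.border_pos hl
  have hkn := hk.border_le l.castSucc
  have hsub : (Finset.univ.filter fun a => rank M' a < rank M' i + 1) ⊆
      insert i (Finset.univ.filter fun a => rank M a < k l.castSucc - 1) := by
    intro a ha
    rw [Finset.mem_filter] at ha
    rw [Finset.mem_insert, Finset.mem_filter]
    by_contra! hcon
    have h1 := h a hcon.1 (by have := hcon.2 (Finset.mem_univ a); omega)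
    rw [score_lt_score_iff hM'] at h1
    omega
  have hcard := (Finset.card_le_card hsub).trans (Finset.card_insert_le _ _)
  rw [card_filter_rank_lt M' (rank_lt M' i), card_filter_rank_lt M (by omega)] at hcard
  omega

end TargetChange

/-! ### The lower bound -/

/-- The two answers are disjoint events at any common time, and the correct one for `M'` takes up
probability 1 - δ in the limit. -/
theorem toOuterMeasure_targetSet_le {A : RankingAlgorithm n L} {M M' : ComparisonMatrix n}
    {k : Fin (L + 1) → ℕ} {δ : ℝ} (hδ : 0 < δ) (hδ1 : δ ≤ 1) (hA : IsAccurate k δ A M')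
    (hne : targetSet k M ≠ targetSet k M') (t : ℕ) :
    (run A M' t).toOuterMeasure {c | ∃ out, c.2 = some out ∧ out = targetSet k M} ≤
      ENNReal.ofReal δ := by
  set E : Set (Config n L) := {c | ∃ out, c.2 = some out ∧ out = targetSet k M} with hE
  set E' : Set (Config n L) := {c | ∃ out, c.2 = some out ∧ out = targetSet k M'} with hE'
  have hmono := toOuterMeasure_run_mono A M' fun _ out => out = targetSet k M
  have hmono' := toOuterMeasure_run_mono A M' fun _ out => out = targetSet k M'
  have hs : ∀ s, (run A M' t).toOuterMeasure E + (run A M' s).toOuterMeasure E' ≤ 1 := by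
    intro s
    calc _ ≤ (run A M' (max t s)).toOuterMeasure E + (run A M' (max t s)).toOuterMeasure E' :=
          add_le_add (hmono (le_max_left t s)) (hmono' (le_max_right t s))
      _ ≤ (run A M' (max t s)).toOuterMeasure E + (run A M' (max t s)).toOuterMeasure Eᶜ := by
          gcongr
          rintro c ⟨out, ho, h1⟩ ⟨out', ho', h2⟩
          rw [ho] at ho'
          exact hne (by rw [← h2, ← h1, Option.some.inj ho'])
      _ = 1 := toOuterMeasure_add_compl _ _
  have h1 : (run A M' t).toOuterMeasure E + ENNReal.ofReal (1 - δ) ≤ 1 :=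
    calc _ ≤ (run A M' t).toOuterMeasure E + ⨆ s, (run A M' s).toOuterMeasure E' := by
          gcongr
          exact hA
      _ ≤ 1 := by
          rw [ENNReal.add_iSup]
          exact iSup_le hs
  have h2 : (1 : ℝ≥0∞) = ENNReal.ofReal δ + ENNReal.ofReal (1 - δ) := by
    rw [← ENNReal.ofReal_add hδ.le (by linarith)]
    simp
  rw [h2] at h1
  exact (ENNReal.add_le_add_iff_right ENNReal.ofReal_ne_top).1 h1

/-- The bound 0.14 is made for this: 1/0.28 > 3 > e. -/
theorem one_le_log_inv_two_mul {δ : ℝ} (hδ : 0 < δ) (hδ' : δ ≤ 0.14) :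
    1 ≤ Real.log (1 / (2 * δ)) := by
  rw [Real.le_log_iff_exp_le (by positivity)]
  have h1 := Real.exp_one_lt_d9
  have h2 : 3 ≤ 1 / (2 * δ) := by
    rw [le_div_iff₀ (by positivity)]
    linarith
  linarith

section LowerBound

variable {A : RankingAlgorithm n L} {k : Fin (L + 1) → ℕ} {δ : ℝ}
  (hA : IsUniformlyAccurate k δ A (comparisonClass n (1 / 8))) (hn : 2 ≤ n)
  (hk : IsBorders n L k) (hδ : 0 < δ) (hδ' : δ ≤ 0.14)
  {M : ComparisonMatrix n} (hM : M ∈ comparisonClass n (3 / 8)) {t : ℕ}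
  (ht : ENNReal.ofReal (3 / 4) ≤
    (run A M t).toOuterMeasure {c | ∃ out, c.2 = some out ∧ out = targetSet k M})
  {l : Fin L} {i : Fin n}

include hA hδ hδ' ht in
-- The event "correct answer for `M`" has probability at least 3/4 under `M` and at most δ under the
-- shifted matrix. The choice c = 1/(2δ) makes the error term cδ equal to 1/2.
theorem log_div_sq_le_expect_involved {x g : ℝ} (hx : |x| ≤ 1 / 4) (hg : 0 < g) (hxg : |x| ≤ g)
    (hM' : shift hM i hx ∈ comparisonClass n (1 / 8))
    (hne : targetSet k M ≠ targetSet k (shift hM i hx)) :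
    ENNReal.ofReal (Real.log (1 / (2 * δ)) / 40 * f₀ g) ≤
      expect (run A M t) fun c => (involved i c.1 : ℝ≥0∞) := by
  have hlog := one_le_log_inv_two_mul hδ hδ'
  set y := Real.log (1 / (2 * δ)) with hy
  have hc : 1 ≤ 1 / (2 * δ) := by
    rw [le_div_iff₀ (by positivity)]
    linarith
  have h1 := log_mul_toOuterMeasure_le (A := A) (likelihoodRatio_shift_le hM i hx)
    (expect_outcome_log_likelihoodRatio_shift hM i hx) t
    {c | ∃ out, c.2 = some out ∧ out = targetSet k M} hc
  have h2 := toOuterMeasure_targetSet_le hδ (by linarith) (hA _ hM') hne t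
  set N := expect (run A M t) fun c => (involved i c.1 : ℝ≥0∞)
  have hxg2 : 10 * x ^ 2 ≤ 10 * g ^ 2 := by
    have := sq_le_sq' (by linarith [abs_nonneg x]) hxg
    rw [sq_abs] at this
    linarith
  have h3 : ENNReal.ofReal (y * (3 / 4)) ≤ ENNReal.ofReal (10 * g ^ 2) * N +
      ENNReal.ofReal (1 / 2) := by
    calc ENNReal.ofReal (y * (3 / 4)) = ENNReal.ofReal y * ENNReal.ofReal (3 / 4) :=
          ENNReal.ofReal_mul (by linarith)
      _ ≤ _ := mul_le_mul_right ht _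
      _ ≤ _ := h1
      _ ≤ ENNReal.ofReal (10 * g ^ 2) * N + ENNReal.ofReal (1 / (2 * δ)) * ENNReal.ofReal δ := by
          gcongr
      _ = _ := by
          rw [← ENNReal.ofReal_mul (by positivity)]
          congr 2
          field_simp
  -- 3y/4 - 1/2 ≥ y/4 because y ≥ 1.
  have h4 : ENNReal.ofReal (y / 4) ≤ ENNReal.ofReal (10 * g ^ 2) * N := by
    have : ENNReal.ofReal (y / 4) + ENNReal.ofReal (1 / 2) ≤ ENNReal.ofReal (y * (3 / 4)) := by
      rw [← ENNReal.ofReal_add (by linarith) (by norm_num)]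
      exact ENNReal.ofReal_le_ofReal (by linarith)
    exact (ENNReal.add_le_add_iff_right ENNReal.ofReal_ne_top).1 (this.trans h3)
  have hgpos : 0 < 10 * g ^ 2 := by positivity
  have e : y / 40 * f₀ g = y / 4 / (10 * g ^ 2) := by
    rw [f₀]
    field_simp
    norm_num
  rw [e, ENNReal.ofReal_div_of_pos hgpos]
  exact ENNReal.div_le_of_le_mul' h4

include hn hM in
theorem score_mem_of_mem_comparisonClass (i : Fin n) :
    3 / 8 ≤ score M i ∧ score M i ≤ 5 / 8 :=
  score_mem_of_forall_mem hn M i (fun j _ => hM.1 i j) fun j _ =>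
    (prob_le_of_mem_comparisonClass hM i j).trans (by norm_num)

include hA hn hk hδ hδ' hM ht in
-- Weakening `i` drops it below `q`, the first item behind its set, and hence below every other item
-- that ranks no later than `q`.
theorem gapLo_le_expect_involved (hi : i ∈ targetSet k M l) (hl : (l : ℕ) + 1 ≠ L) :
    ENNReal.ofReal (Real.log (1 / (2 * δ)) / 40 * f₀ (gapLo k M l i)) ≤
      expect (run A M t) fun c => (involved i c.1 : ℝ≥0∞) := by
  have hM0 : M ∈ comparisonClass n 0 := comparisonClass_anti (by norm_num) hM
  have hg := (gapLo_mem hM0 hk hi hn hl).1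
  obtain ⟨s, hs1, hs2, hs3, hs4⟩ := exists_generic_shift (M := M) i hn hg (Or.inr rfl)
  have hpos := hk.border_lt hl
  obtain ⟨q, hq, hqs⟩ := orderedScore_eq M (r := k l.succ + 1) (by omega)
  have hgap : gapLo k M l i = score M i - score M q := by rw [gapLo, hqs]
  have hsi := score_mem_of_mem_comparisonClass hn hM i
  have hsq := score_mem_of_mem_comparisonClass hn hM q
  have habs : |-1 * s| = s := by rw [neg_one_mul, abs_neg, abs_of_pos hs2]
  -- All scores lie in [3/8, 5/8], so no gap exceeds 1/4.
  have hx : |-1 * s| ≤ 1 / 4 := by rw [habs]; linarith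
  have hM' := shift_mem_comparisonClass hM i hx hn hs4
  refine log_div_sq_le_expect_involved hA hδ hδ' hM ht hx hg (by rw [habs]; exact hs3.le) hM' ?_
  intro heq
  rw [heq] at hi
  refine notMem_targetSet_of_overtaken (M := M) (comparisonClass_anti (by norm_num) hM') hk hl
    (fun a ha hr => ?_) hi
  have hle : score M q ≤ score M a := (score_le_score_iff hM0).2 (by omega)
  rw [score_shift_self hM i hx hn, score_shift_of_ne hM i hx ha]
  have : -1 * s / ((n : ℝ) - 1) = -(s / ((n : ℝ) - 1)) := by ring
  linarith

include hA hn hk hδ hδ' hM ht in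
-- The mirror image: strengthening `i` lifts it above the last item in front of its set.
theorem gapUp_le_expect_involved (hi : i ∈ targetSet k M l) (hl : (l : ℕ) ≠ 0) :
    ENNReal.ofReal (Real.log (1 / (2 * δ)) / 40 * f₀ (gapUp k M l i)) ≤
      expect (run A M t) fun c => (involved i c.1 : ℝ≥0∞) := by
  have hM0 : M ∈ comparisonClass n 0 := comparisonClass_anti (by norm_num) hM
  have hg := (gapUp_mem hM0 hk hi hn hl).1
  obtain ⟨s, hs1, hs2, hs3, hs4⟩ := exists_generic_shift (M := M) i hn hg (Or.inl rfl)
  have hpos := hk.border_pos hl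
  obtain ⟨q, hq, hqs⟩ := orderedScore_eq M (r := k l.castSucc)
    (by have := hk.border_le l.castSucc; omega)
  have hgap : gapUp k M l i = score M q - score M i := by rw [gapUp, hqs]
  have hsi := score_mem_of_mem_comparisonClass hn hM i
  have hsq := score_mem_of_mem_comparisonClass hn hM q
  have habs : |1 * s| = s := by rw [one_mul, abs_of_pos hs2]
  have hx : |1 * s| ≤ 1 / 4 := by rw [habs]; linarith
  have hM' := shift_mem_comparisonClass hM i hx hn hs4
  refine log_div_sq_le_expect_involved hA hδ hδ' hM ht hx hg (by rw [habs]; exact hs3.le) hM' ?_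
  intro heq
  rw [heq] at hi
  refine notMem_targetSet_of_overtaking (M := M) (comparisonClass_anti (by norm_num) hM') hk hl
    (fun a ha hr => ?_) hi
  have hle : score M a ≤ score M q := (score_le_score_iff hM0).2 (by omega)
  rw [score_shift_self hM i hx hn, score_shift_of_ne hM i hx ha]
  have : 1 * s / ((n : ℝ) - 1) = s / ((n : ℝ) - 1) := by ring
  linarith

include hA hn hk hδ hδ' hM ht in
theorem gapTerm_le_expect_involved (hL : 2 ≤ L) (hi : i ∈ targetSet k M l) :
    ENNReal.ofReal (Real.log (1 / (2 * δ)) / 40 * gapTerm f₀ k M l i) ≤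
      expect (run A M t) fun c => (involved i c.1 : ℝ≥0∞) := by
  unfold gapTerm
  split_ifs with h0 h1
  · exact gapLo_le_expect_involved hA hn hk hδ hδ' hM ht hi (by omega)
  · exact gapUp_le_expect_involved hA hn hk hδ hδ' hM ht hi h0
  · rcases max_choice (f₀ (gapLo k M l i)) (f₀ (gapUp k M l i)) with h | h <;> rw [h]
    · exact gapLo_le_expect_involved hA hn hk hδ hδ' hM ht hi h1
    · exact gapUp_le_expect_involved hA hn hk hδ hδ' hM ht hi h0

end LowerBound

theorem gapTerm_f₀_nonneg (k : Fin (L + 1) → ℕ) (M : ComparisonMatrix n) (l : Fin L)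
    (i : Fin n) : 0 ≤ gapTerm f₀ k M l i := by
  have h : ∀ x, 0 ≤ f₀ x := fun x => by unfold f₀; positivity
  unfold gapTerm
  split_ifs
  · exact h _
  · exact h _
  · exact (h _).trans (le_max_left _ _)

theorem lower_bound_expectedComparisons {A : RankingAlgorithm n L} {k : Fin (L + 1) → ℕ} {δ : ℝ}
    (hn : 2 ≤ n) (hL : 2 ≤ L) (hk : IsBorders n L k) (hδ : 0 < δ) (hδ' : δ ≤ 0.14)
    (hA : IsUniformlyAccurate k δ A (comparisonClass n (1 / 8))) {M : ComparisonMatrix n}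
    (hM : M ∈ comparisonClass n (3 / 8)) :
    ENNReal.ofReal (1 / 80 * Real.log (1 / (2 * δ)) * gapSum f₀ k M) ≤
      expectedComparisons A M := by
  choose c hc using hk.exists_mem_targetSet M
  have hacc := hA M (comparisonClass_anti (by norm_num) hM)
  -- Since 1 - δ ≥ 0.86 > 3/4, one finite time serves all items. The final 80 is 40 times the two
  -- items of a comparison.
  obtain ⟨t, ht⟩ := lt_iSup_iff.1 (lt_of_lt_of_le
    ((ENNReal.ofReal_lt_ofReal_iff (by linarith)).2 (by linarith : (3 / 4 : ℝ) < 1 - δ)) hacc)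
  have hlog := one_le_log_inv_two_mul hδ hδ'
  have hsum : ENNReal.ofReal (Real.log (1 / (2 * δ)) / 40 * gapSum f₀ k M) ≤
      2 * expectedComparisons A M := by
    rw [gapSum_eq_sum_gapTerm hk M f₀ hc, Finset.mul_sum, ENNReal.ofReal_sum_of_nonneg
      fun i _ => mul_nonneg (by linarith) (gapTerm_f₀_nonneg k M _ _)]
    calc _ ≤ ∑ i, expect (run A M t) fun c => (involved i c.1 : ℝ≥0∞) :=
          Finset.sum_le_sum fun i _ =>
            gapTerm_le_expect_involved hA hn hk hδ hδ' hM ht.le hL (hc i)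
      _ = expect (run A M t) fun c => ∑ i, (involved i c.1 : ℝ≥0∞) := (expect_sum _ _ _).symm
      _ ≤ expect (run A M t) fun c => 2 * (c.1.length : ℝ≥0∞) :=
          expect_mono fun c _ => by exact_mod_cast sum_involved_le c.1
      _ = 2 * expect (run A M t) fun c => (c.1.length : ℝ≥0∞) := expect_const_mul _ _ _
      _ ≤ _ := by
          gcongr
          exact expect_length_le_expectedComparisons A M t
  have e : 1 / 80 * Real.log (1 / (2 * δ)) * gapSum f₀ k M =
      Real.log (1 / (2 * δ)) / 40 * gapSum f₀ k M / 2 := by ring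
  rw [e, ENNReal.ofReal_div_of_pos (by norm_num)]
  refine ENNReal.div_le_of_le_mul' ?_
  simpa using hsum

end ActiveRanking

end

theorem theorem1 :
    ∃ cUp cLow : ℝ, 0 < cUp ∧ 0 < cLow ∧
      ∀ (n L : ℕ) (hn : 2 ≤ n) (_hL : 2 ≤ L) (k : Fin (L + 1) → ℕ) (_hk : IsBorders n L k)
        (δ : ℝ) (_hδ : 0 < δ) (_hδ' : δ ≤ 0.14),
        -- the upper bound for the AR algorithm
        (∀ M ∈ comparisonClass n 0,
          IsAccurate k δ (activeRanking hn k δ) M ∧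
          ENNReal.ofReal (1 - δ) ≤
            probTerminates (activeRanking hn k δ) M (fun h out =>
              out = targetSet k M ∧
              (h.length : ℝ) ≤ cUp * Real.log (n / δ) * gapSum fAR k M)) ∧
        -- the lower bound for every uniformly accurate algorithm
        (∀ A : RankingAlgorithm n L,
          IsUniformlyAccurate k δ A (comparisonClass n (1 / 8)) →
          ∀ M ∈ comparisonClass n (3 / 8),
            ENNReal.ofReal (cLow * Real.log (1 / (2 * δ)) * gapSum f₀ k M) ≤
              expectedComparisons A M) := by
  refine ⟨8192, 1 / 80, by norm_num, by norm_num, fun n L hn hL k hk δ hδ hδ' =>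
    ⟨fun M hM => ?_, fun A hA M hM => lower_bound_expectedComparisons hn hL hk hδ hδ' hA hM⟩⟩
  have h := activeRanking_upper_bound hn hL hk hδ hδ' hM
  exact ⟨h.trans (probTerminates_mono fun _ _ hq => hq.1), h⟩
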